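/- **Setting.** Let $\mathcal N$ be a smooth manifold (Hausdorff, second countable, no boundary) of dimension $\mathfrak n\ge 2$. *Null hypersurface data* $\{\mathcal N,\gamma,\ell,\ell^{(2)},Y\}$ consist of a smooth symmetric $(0,2)$-tensor field $\gamma$ with one-dimensional radical at every point, a smooth covector field $\ell$, a smooth function $\ell^{(2)}$ such that the symmetric bilinear form on $T_p\mathcal N\oplus\mathbb R$ $$\mathcal A|_p\big((X_1,a_1),(X_2,a_2)\big)=\gamma(X_1,X_2)+a_1\ell(X_2)+a_2\ell(X_1)+a_1a_2\ell^{(2)}$$ is non-degenerate at every $p$, and a smooth symmetric $(0,2)$-tensor field $Y$. With $\mathcal A^\sharp$ the inverse of $\mathcal A$, put $P(\omega_1,\omega_2)=\mathcal A^\sharp((\omega_1,0),(\omega_2,0))$ and $n(\omega)=\mathcal A^\sharp((\omega,0),(0,1))$. Then $\gamma_{ab}n^b=0$, $\ell_an^a=1$, $P^{ab}\ell_b+\ell^{(2)}n^a=0$ and $P^{ab}\gamma_{bc}+n^a\ell_c=\delta^a_c$. Parentheses around indices denote symmetrization with the factor $\tfrac12$. Define $U=\tfrac12\pounds_n\gamma$,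 $F=\tfrac12 d\ell$, $s_b=F_{ab}n^a$, $r_b=Y_{ab}n^a$, $\kappa_n=-Y_{ab}n^an^b$, $\mathrm{tr}_PT=P^{ab}T_{ab}$, and $\mathsf Df=df-n(f)\ell$ for functions $f$. Let $\mathring\nabla$ be the unique torsion-free connection with $$(\mathring\nabla_X\gamma)(Z,W)=-U(X,Z)\ell(W)-U(X,W)\ell(Z),\qquad (\mathring\nabla_X\ell)(Z)+(\mathring\nabla_Z\ell)(X)=-2\ell^{(2)}U(X,Z),$$ and let $\mathring{\mathrm{Ric}}$ be its Ricci tensor: $\mathring{\mathrm{Ric}}(X,W)$ is the trace of $Z\mapsto\mathring\nabla_Z\mathring\nabla_WX-\mathring\nabla_W\mathring\nabla_ZX-\mathring\nabla_{[Z,W]}X$. The *constraint tensor* is $$\begin{aligned}\mathcal R_{ab}={}&\mathring{\mathrm{Ric}}_{(ab)}-2\pounds_nY_{ab}-(2\kappa_n+\mathrm{tr}_PU)Y_{ab}+\mathring\nabla_{(a}\big(s_{b)}+2r_{b)}\big)-2r_ar_b+4r_{(a}s_{b)}-s_as_b\\&-(\mathrm{tr}_PY)U_{ab}+2P^{cd}U_{d(a}\big(2Y_{b)c}+F_{b)c}\big).\end{aligned}$$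 The *energy-momentum map* sends a symmetric $(0,2)$-tensor $V$ to $$\tau(V)^{ab}=(n^aP^{bc}+n^bP^{ac})n^dV_{cd}-P^{ab}n^cn^dV_{cd}-n^an^bP^{cd}V_{cd};$$ let $\mathcal K_0$ be its kernel. For symmetric $V$ put $\mathcal Q_V=V_{ab}n^an^b$, $\overline V^a=P^{ab}V_{bc}n^c-\tfrac12(\mathrm{tr}_PV)n^a$, $\widehat V_a=\gamma_{ab}\overline V^b$, $\mathcal C=\ell\otimes\ell+\frac{\ell^{(2)}}{\mathfrak n-1}\gamma$, and $$V^H=V-\Big(2\ell\otimes_s\widehat V+\mathcal Q_V\,\mathcal C+\frac{\mathrm{tr}_PV}{\mathfrak n-1}\gamma\Big).$$ Define also, for symmetric $(0,2)$-tensor fields $V$ and covector fields $\omega$ with $\omega(n)=0$, $$\overline{\pounds}_nV_{ab}=\pounds_nV_{ab}-2P^{cd}V_{c(a}U_{b)d}-4\widehat V_{(a}s_{b)}-\frac{\mathcal Q_V}{\mathfrak n-1}n(\ell^{(2)})\gamma_{ab},$$ $$\mathcal O(\omega)_{ab}=\mathring\nabla_a\omega_b+\mathring\nabla_b\omega_a-2\ell_{(a}\big(\pounds_n\omega_{b)}-2U_{b)f}P^{fc}\omega_c\big)-\frac{2}{\mathfrak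 n-1}P^{cf}\mathring\nabla_c\omega_f\,\gamma_{ab}.$$ **Theorem.** Write $w=\widehat Y$, so that $r=w-\kappa_n\ell$. Then $$\begin{aligned} \mathcal R_{ab}={}&\mathring{\mathrm{Ric}}_{(ab)}+\mathring\nabla_{(a}s_{b)}+s_as_b+2P^{cd}U_{d(a}F_{b)c}\\ &+\ell_{(a}\big(-2\pounds_nw_{b)}-2\mathsf D_{b)}\kappa_n+4\kappa_ns_{b)}-2(\mathrm{tr}_PU)w_{b)}\big)+\kappa_n(\mathrm{tr}_PU)\,\mathcal C_{ab}\\ &+\frac{2}{\mathfrak n-1}\Big(n(\kappa_n\ell^{(2)}-\mathrm{tr}_PY)+\mathrm{tr}_P\big(\mathring\nabla w-(w+s)\otimes(w+s)\big)+(\kappa_n\ell^{(2)}-\mathrm{tr}_PY)(\kappa_n+\mathrm{tr}_PU)\Big)\gamma_{ab}\\ &-2\overline{\pounds}_nY^H_{ab}+\mathcal O(w)_{ab}-2\big((w+s)\otimes(w+s)\big)^H_{ab}-(2\kappa_n+\mathrm{tr}_PU)Y^H_{ab}+\big(2\ell^{(2)}\kappa_n-\mathrm{tr}_PY\big)U^H_{ab}.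 \end{aligned}$$ Moreover, the covector $-2\pounds_nw-2\mathsf D\kappa_n+4\kappa_ns-2(\mathrm{tr}_PU)w$ in the second line annihilates $n$, and each of the tensors $\overline{\pounds}_nY^H$, $\mathcal O(w)$, $\big((w+s)\otimes(w+s)\big)^H$, $Y^H$, $U^H$ of the last line takes values in $\mathcal K_0$. -/

import Mathlib

open scoped Manifold ContDiff Bundle
open Module (Dual)

noncomputable section

/-! ### Pointwise tensor algebra on a real vector space -/

namespace NullGeometry

section Algebra

variable {V : Type*} [AddCommGroup V] [Module ℝ V]

/-- The tensor product `α ⊗ β` of two covectors. -/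
def tensorProd (α β : Dual ℝ V) : LinearMap.BilinForm ℝ V :=
  LinearMap.mk₂ ℝ (fun u v => α u * β v)
    (by intros; simp [add_mul]) (by intros; simp [mul_assoc])
    (by intros; simp [mul_add]) (by intros; simp [mul_left_comm])

/-- The symmetric part `T_(ab) = ½ (T_ab + T_ba)`. -/
def symPart (T : LinearMap.BilinForm ℝ V) : LinearMap.BilinForm ℝ V :=
  (1 / 2 : ℝ) • (T + LinearMap.flip T)

/-- The symmetrized tensor product `α ⊗ₛ β = ½ (α ⊗ β + β ⊗ α)`; in indices `α_(a β_b)`. -/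
def symProd (α β : Dual ℝ V) : LinearMap.BilinForm ℝ V :=
  symPart (tensorProd α β)

/-- The bilinear form `𝒜` on `V ⊕ ℝ`:
`𝒜((X₁,a₁),(X₂,a₂)) = γ(X₁,X₂) + a₁ ℓ(X₂) + a₂ ℓ(X₁) + a₁ a₂ c`. -/
def ambientForm (g : LinearMap.BilinForm ℝ V) (l : Dual ℝ V) (c : ℝ) :
    LinearMap.BilinForm ℝ (V × ℝ) :=
  LinearMap.mk₂ ℝ (fun x y => g x.1 y.1 + x.2 * l y.1 + y.2 * l x.1 + x.2 * y.2 * c)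
    (by intros; simp; ring) (by intros; simp; ring)
    (by intros; simp; ring) (by intros; simp; ring)

/-- The contraction `P^{cd} S_{ac} T_{bd}`, where the symmetric `(2,0)`-tensor `P` is given as the
map `θ ↦ P(θ, ·)` from covectors to vectors; the two `(0,2)`-tensors are contracted in their second
slots. -/
def contractP (P : Dual ℝ V →ₗ[ℝ] V) (S T : LinearMap.BilinForm ℝ V) :
    LinearMap.BilinForm ℝ V :=
  LinearMap.mk₂ ℝ (fun u v => S u (P (T v)))
    (by intros; simp) (by intros; simp) (by intros; simp) (by intros; simp)

/-- The trace `tr_P T = P^{ab} T_{ab}`, i.e. the trace of the endomorphism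
`u^a ↦ P^{bc} T_{ac} u^a`. -/
def traceP (P : Dual ℝ V →ₗ[ℝ] V) (T : LinearMap.BilinForm ℝ V) : ℝ :=
  LinearMap.trace ℝ V (P ∘ₗ T)

end Algebra

/-! ### Tensor calculus on a manifold -/

section Calculus

variable {n : ℕ} {N : Type*} [TopologicalSpace N] [ChartedSpace (EuclideanSpace ℝ (Fin n)) N]

/-- (Rough) vector fields. -/
abbrev VField (n : ℕ) (N : Type*) [TopologicalSpace N]
    [ChartedSpace (EuclideanSpace ℝ (Fin n)) N] : Type _ :=
  (q : N) → TangentSpace (𝓡 n) q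

/-- (Rough) covector fields. -/
abbrev CovField (n : ℕ) (N : Type*) [TopologicalSpace N]
    [ChartedSpace (EuclideanSpace ℝ (Fin n)) N] : Type _ :=
  (q : N) → Dual ℝ (TangentSpace (𝓡 n) q)

/-- (Rough) `(0,2)`-tensor fields. -/
abbrev Tensor02Field (n : ℕ) (N : Type*) [TopologicalSpace N]
    [ChartedSpace (EuclideanSpace ℝ (Fin n)) N] : Type _ :=
  (q : N) → LinearMap.BilinForm ℝ (TangentSpace (𝓡 n) q)

/-- The differential of a function, as a covector field. -/
def dd (f : N → ℝ) : CovField n N := fun p =>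
  (mvfderiv (𝓡 n) f p : TangentSpace (𝓡 n) p →L[ℝ] ℝ).toLinearMap

variable [IsManifold (𝓡 n) ∞ N]

/-- The vector field `X` is smooth on a neighbourhood of `p`. -/
def SmoothNear (X : VField n N) (p : N) : Prop :=
  ∀ᶠ q in nhds p, ContMDiffAt (𝓡 n) (𝓡 n).tangent ∞
    (fun q' => (⟨q', X q'⟩ : TangentBundle (𝓡 n) N)) q

open Classical in
/-- The linear map on `T_p N` determined by an operation `Φ` on vector fields which is tensorial
at `p`, i.e. whose value on a vector field `X` smooth near `p` only depends, and depends linearly,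
on `X(p)`. (Every tangent vector extends to such a field, so the map is unique; it is `0` by
convention if `Φ` is not tensorial at `p`.) -/
def linearAt {F : Type*} [AddCommGroup F] [Module ℝ F] (p : N) (Φ : VField n N → F) :
    TangentSpace (𝓡 n) p →ₗ[ℝ] F :=
  if h : ∃ L : TangentSpace (𝓡 n) p →ₗ[ℝ] F,
      ∀ X : VField n N, SmoothNear X p → L (X p) = Φ X
  then h.choose else 0

open Classical in
/-- The `(0,2)`-tensor at `p` determined by an operation `Φ` on pairs of vector fields which is
tensorial at `p` in both arguments (and `0` by convention if it is not). -/
def tensorAt (p : N) (Φ : VField n N → VField n N → ℝ) :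
    LinearMap.BilinForm ℝ (TangentSpace (𝓡 n) p) :=
  if h : ∃ B : LinearMap.BilinForm ℝ (TangentSpace (𝓡 n) p),
      ∀ X Z : VField n N, SmoothNear X p → SmoothNear Z p → B (X p) (Z p) = Φ X Z
  then h.choose else 0

/-- The Lie bracket `[X, Z]` at `p`. -/
def bracket (X Z : VField n N) : VField n N := VectorField.mlieBracket (𝓡 n) X Z

/-- Lie derivative of a covector field: `(£_X θ)(Z) = X(θ(Z)) - θ([X,Z])`. -/
def lieCov (X : VField n N) (θ : CovField n N) : CovField n N := fun p =>
  linearAt p fun Z => dd (fun q => θ q (Z q)) p (X p) - θ p (bracket X Z p)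

/-- Lie derivative of a `(0,2)`-tensor field:
`(£_X T)(Z,W) = X(T(Z,W)) - T([X,Z],W) - T(Z,[X,W])`. -/
def lieTensor (X : VField n N) (T : Tensor02Field n N) : Tensor02Field n N := fun p =>
  tensorAt p fun Z W => dd (fun q => T q (Z q) (W q)) p (X p)
    - T p (bracket X Z p) (W p) - T p (Z p) (bracket X W p)

/-- Exterior derivative of a covector field:
`dθ(X,Z) = X(θ(Z)) - Z(θ(X)) - θ([X,Z])`. -/
def extDerivCov (θ : CovField n N) : Tensor02Field n N := fun p =>
  tensorAt p fun X Z => dd (fun q => θ q (Z q)) p (X p) - dd (fun q => θ q (X q)) p (Z p)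
    - θ p (bracket X Z p)

/-- The operator underlying a linear connection on the tangent bundle; `cov Z p (X p)` is
`∇_X Z` at `p`. -/
abbrev ConnectionMap (n : ℕ) (N : Type*) [TopologicalSpace N]
    [ChartedSpace (EuclideanSpace ℝ (Fin n)) N] : Type _ :=
  VField n N → (q : N) → (TangentSpace (𝓡 n) q →L[ℝ] TangentSpace (𝓡 n) q)

/-- The vector field `∇_X Z`. -/
def covDeriv (cov : ConnectionMap n N) (X Z : VField n N) : VField n N :=
  fun q => cov Z q (X q)

/-- Covariant derivative of a covector field, `(∇θ)(X,Z) = (∇_X θ)(Z) = X(θ(Z)) - θ(∇_X Z)`;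
in indices `∇_a θ_b`, the index of the derivative first. -/
def nablaCov (cov : ConnectionMap n N) (θ : CovField n N) : Tensor02Field n N := fun p =>
  tensorAt p fun X Z => dd (fun q => θ q (Z q)) p (X p) - θ p (covDeriv cov X Z p)

/-- The curvature operator `∇_Z ∇_W X - ∇_W ∇_Z X - ∇_{[Z,W]} X`. -/
def curvature (cov : ConnectionMap n N) (X Z W : VField n N) : VField n N :=
  covDeriv cov Z (covDeriv cov W X) - covDeriv cov W (covDeriv cov Z X)
    - covDeriv cov (bracket Z W) X

/-- The (not necessarily symmetric) Ricci tensor: `Ric(X,W)` is the trace of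
`Z ↦ ∇_Z ∇_W X - ∇_W ∇_Z X - ∇_{[Z,W]} X`. -/
def ricci (cov : ConnectionMap n N) : Tensor02Field n N := fun p =>
  tensorAt p fun X W =>
    LinearMap.trace ℝ (TangentSpace (𝓡 n) p) (linearAt p fun Z => curvature cov X Z W p)

end Calculus

/-! ### Null hypersurface data -/

/-- Null metric hypersurface data `{N, γ, ℓ, ℓ⁽²⁾}` on an `n`-dimensional manifold `N`. -/
structure NullMetricHypersurfaceData (n : ℕ) (N : Type*) [TopologicalSpace N]
    [ChartedSpace (EuclideanSpace ℝ (Fin n)) N] [IsManifold (𝓡 n) ∞ N] where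
  /-- the degenerate metric `γ` -/
  metric : (p : N) → TangentSpace (𝓡 n) p →L[ℝ] TangentSpace (𝓡 n) p →L[ℝ] ℝ
  /-- the covector field `ℓ` -/
  covec : (p : N) → TangentSpace (𝓡 n) p →L[ℝ] ℝ
  /-- the function `ℓ⁽²⁾` -/
  ell2 : N → ℝ
  metric_smooth : ContMDiff (𝓡 n)
    ((𝓡 n).prod 𝓘(ℝ, EuclideanSpace ℝ (Fin n) →L[ℝ] EuclideanSpace ℝ (Fin n) →L[ℝ] ℝ)) ∞
    (fun p => Bundle.TotalSpace.mk'
      (EuclideanSpace ℝ (Fin n) →L[ℝ] EuclideanSpace ℝ (Fin n) →L[ℝ] ℝ)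
      (E := fun p : N => TangentSpace (𝓡 n) p →L[ℝ] TangentSpace (𝓡 n) p →L[ℝ] ℝ) p (metric p))
  covec_smooth : ContMDiff (𝓡 n)
    ((𝓡 n).prod 𝓘(ℝ, EuclideanSpace ℝ (Fin n) →L[ℝ] ℝ)) ∞
    (fun p => Bundle.TotalSpace.mk' (EuclideanSpace ℝ (Fin n) →L[ℝ] ℝ)
      (E := fun p : N => TangentSpace (𝓡 n) p →L[ℝ] ℝ) p (covec p))
  ell2_smooth : ContMDiff (𝓡 n) 𝓘(ℝ, ℝ) ∞ ell2
  metric_symm : ∀ (p : N) (u v : TangentSpace (𝓡 n) p), metric p u v = metric p v u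
  /-- the radical of `γ` is one-dimensional at every point -/
  radical_finrank : ∀ p : N, Module.finrank ℝ (LinearMap.ker (metric p).toLinearMap₁₂) = 1
  ambient_nondegenerate : ∀ p : N,
    (ambientForm (metric p).toLinearMap₁₂ (covec p).toLinearMap (ell2 p)).Nondegenerate

namespace NullMetricHypersurfaceData

variable {n : ℕ} {N : Type*} [TopologicalSpace N] [ChartedSpace (EuclideanSpace ℝ (Fin n)) N]
  [IsManifold (𝓡 n) ∞ N] (D : NullMetricHypersurfaceData n N)

/-- The tensor field `γ`. -/
def γ : Tensor02Field n N := fun p => (D.metric p).toLinearMap₁₂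

/-- The covector field `ℓ`. -/
def ℓ : CovField n N := fun p => (D.covec p).toLinearMap

/-- The isomorphism of `T_p N ⊕ ℝ` onto its dual defined by `𝒜`; its inverse is `𝒜♯`. -/
def ambientEquiv (p : N) :
    (TangentSpace (𝓡 n) p × ℝ) ≃ₗ[ℝ] Dual ℝ (TangentSpace (𝓡 n) p × ℝ) :=
  haveI : FiniteDimensional ℝ (TangentSpace (𝓡 n) p) :=
    inferInstanceAs (FiniteDimensional ℝ (EuclideanSpace ℝ (Fin n)))
  LinearMap.BilinForm.toDual _ (D.ambient_nondegenerate p)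

/-- The vector field `n`, `n(θ) = 𝒜♯((θ,0),(0,1))`. -/
def nvec : VField n N := fun p => ((D.ambientEquiv p).symm (LinearMap.snd ℝ _ _)).1

/-- The symmetric `(2,0)`-tensor `P(θ₁,θ₂) = 𝒜♯((θ₁,0),(θ₂,0))`, as the map `θ ↦ P(θ,·)` from
covectors to vectors; `P(θ₁,θ₂) = θ₁(P θ₂)`. -/
def P (p : N) : Dual ℝ (TangentSpace (𝓡 n) p) →ₗ[ℝ] TangentSpace (𝓡 n) p :=
  LinearMap.fst ℝ _ _ ∘ₗ (D.ambientEquiv p).symm.toLinearMap ∘ₗ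
    (LinearMap.fst ℝ (TangentSpace (𝓡 n) p) ℝ).dualMap

/-- `U = ½ £_n γ`. -/
def U : Tensor02Field n N := fun p => (1 / 2 : ℝ) • lieTensor D.nvec D.γ p

/-- `F = ½ dℓ`. -/
def F : Tensor02Field n N := fun p => (1 / 2 : ℝ) • extDerivCov D.ℓ p

/-- `s = ι_n F`, i.e. `s_b = F_{ab} n^a`. -/
def s : CovField n N := fun p => D.F p (D.nvec p)

/-- `cov` is a torsion-free connection on `N` with
`(∇_X γ)(Z,W) = -U(X,Z) ℓ(W) - U(X,W) ℓ(Z)` and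
`(∇_X ℓ)(Z) + (∇_Z ℓ)(X) = -2 ℓ⁽²⁾ U(X,Z)`. -/
def IsMetricHypersurfaceConnection
    (cov : CovariantDerivative (𝓡 n) (EuclideanSpace ℝ (Fin n))
      (TangentSpace (𝓡 n) : N → Type _)) : Prop :=
  cov.torsion = 0 ∧
  (∀ (p : N) (X Z W : VField n N), SmoothNear X p → SmoothNear Z p → SmoothNear W p →
    dd (fun q => D.γ q (Z q) (W q)) p (X p)
        - D.γ p (covDeriv cov X Z p) (W p) - D.γ p (Z p) (covDeriv cov X W p)
      = - D.U p (X p) (Z p) * D.ℓ p (W p) - D.U p (X p) (W p) * D.ℓ p (Z p)) ∧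
  (∀ (p : N) (X Z : VField n N), SmoothNear X p → SmoothNear Z p →
    (dd (fun q => D.ℓ q (Z q)) p (X p) - D.ℓ p (covDeriv cov X Z p))
        + (dd (fun q => D.ℓ q (X q)) p (Z p) - D.ℓ p (covDeriv cov Z X p))
      = -2 * D.ell2 p * D.U p (X p) (Z p))

open Classical in
/-- The metric hypersurface connection `∇̊`: the torsion-free connection determined (on smooth
fields) by the properties in `IsMetricHypersurfaceConnection`. -/
def conn : ConnectionMap n N :=
  if h : ∃ cov, D.IsMetricHypersurfaceConnection cov then h.choose.toFun else fun _ _ => 0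

/-- `tr_P T = P^{ab} T_{ab}`. -/
def trP (T : Tensor02Field n N) : N → ℝ := fun p => traceP (D.P p) (T p)

/-- `𝒬_T = T(n,n)`. -/
def Q (T : Tensor02Field n N) : N → ℝ := fun p => T p (D.nvec p) (D.nvec p)

/-- `ι_n T = T(n,·)`. -/
def iotaN (T : Tensor02Field n N) : CovField n N := fun p => T p (D.nvec p)

/-- The vector `T̄^a = P^{ab} (ι_n T)_b - ½ (tr_P T) n^a`. -/
def barVec (T : Tensor02Field n N) : VField n N := fun p =>
  D.P p (D.iotaN T p) - (1 / 2 * D.trP T p) • D.nvec p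

/-- The covector `γ(T̄,·)`. -/
def barCov (T : Tensor02Field n N) : CovField n N := fun p => D.γ p (D.barVec T p)

/-- The energy-momentum map at `p`, with values in bilinear forms on covectors:
`τ(T)^{ab} = (n^a P^{bc} + n^b P^{ac}) n^d T_{cd} - P^{ab} n^c n^d T_{cd}
  - n^a n^b P^{cd} T_{cd}`. -/
def tau (p : N) (T : LinearMap.BilinForm ℝ (TangentSpace (𝓡 n) p))
    (α β : Dual ℝ (TangentSpace (𝓡 n) p)) : ℝ :=
  α (D.nvec p) * β (D.P p (T (D.nvec p))) + β (D.nvec p) * α (D.P p (T (D.nvec p)))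
    - α (D.P p β) * T (D.nvec p) (D.nvec p)
    - α (D.nvec p) * β (D.nvec p) * traceP (D.P p) T

/-- The kernel `𝒦₀` at `p` of the energy-momentum map on symmetric `(0,2)`-tensors. -/
def kernelTau (p : N) : Set (LinearMap.BilinForm ℝ (TangentSpace (𝓡 n) p)) :=
  {T | (∀ u v, T u v = T v u) ∧ ∀ α β, D.tau p T α β = 0}

/-- `𝒞 = ℓ ⊗ ℓ + ℓ⁽²⁾/(n-1) γ`. -/
def C : Tensor02Field n N := fun p =>
  tensorProd (D.ℓ p) (D.ℓ p) + (D.ell2 p / ((n : ℝ) - 1)) • D.γ p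

/-- The projector `ℙ(T) = 2 ℓ ⊗ₛ γ(T̄,·) + 𝒬_T 𝒞 + (tr_P T)/(n-1) γ`. -/
def proj (T : Tensor02Field n N) : Tensor02Field n N := fun p =>
  (2 : ℝ) • symProd (D.ℓ p) (D.barCov T p) + D.Q T p • D.C p
    + (D.trP T p / ((n : ℝ) - 1)) • D.γ p

/-- The component `T^H = T - ℙ(T)` of `T` in the kernel of the energy-momentum map. -/
def partH (T : Tensor02Field n N) : Tensor02Field n N := fun p => T p - D.proj T p

/-- The algebraic map `𝔅(T)_{ab} = -2 P^{cd} T_{c(a} U_{b)d} - 4 γ(T̄,·)_{(a} s_{b)}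
  - 𝒬_T/(n-1) n(ℓ⁽²⁾) γ_{ab}`, for symmetric `T`. -/
def Bmap (T : Tensor02Field n N) : Tensor02Field n N := fun p =>
  (-2 : ℝ) • symPart (contractP (D.P p) (LinearMap.flip (T p)) (D.U p))
    - (4 : ℝ) • symProd (D.barCov T p) (D.s p)
    - (D.Q T p / ((n : ℝ) - 1) * dd D.ell2 p (D.nvec p)) • D.γ p

/-- The operator `£̄_n T = £_n T + 𝔅(T)`. -/
def lieBar (T : Tensor02Field n N) : Tensor02Field n N := fun p =>
  lieTensor D.nvec T p + D.Bmap T p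

/-- The operator `𝒪(θ)_{ab} = ∇̊_a θ_b + ∇̊_b θ_a - 2 ℓ_{(a}(£_n θ_{b)} - 2 U_{b)f} P^{fc} θ_c)
  - 2/(n-1) P^{cf} ∇̊_c θ_f γ_{ab}`. -/
def Oop (θ : CovField n N) : Tensor02Field n N := fun p =>
  nablaCov D.conn θ p + LinearMap.flip (nablaCov D.conn θ p)
    - (2 : ℝ) • symProd (D.ℓ p)
        (lieCov D.nvec θ p - (2 : ℝ) • LinearMap.flip (D.U p) (D.P p (θ p)))
    - (2 / ((n : ℝ) - 1) * D.trP (nablaCov D.conn θ) p) • D.γ p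

/-- `D f = df - n(f) ℓ`. -/
def Dop (f : N → ℝ) : CovField n N := fun p => dd f p - dd f p (D.nvec p) • D.ℓ p

end NullMetricHypersurfaceData

/-- Null hypersurface data `{N, γ, ℓ, ℓ⁽²⁾, Y}`: null metric hypersurface data together with a
smooth symmetric `(0,2)`-tensor field `Y`. -/
structure NullHypersurfaceData (n : ℕ) (N : Type*) [TopologicalSpace N]
    [ChartedSpace (EuclideanSpace ℝ (Fin n)) N] [IsManifold (𝓡 n) ∞ N] extends
    NullMetricHypersurfaceData n N where
  /-- the tensor field `Y` -/
  ytensor : (p : N) → TangentSpace (𝓡 n) p →L[ℝ] TangentSpace (𝓡 n) p →L[ℝ] ℝ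
  ytensor_smooth : ContMDiff (𝓡 n)
    ((𝓡 n).prod 𝓘(ℝ, EuclideanSpace ℝ (Fin n) →L[ℝ] EuclideanSpace ℝ (Fin n) →L[ℝ] ℝ)) ∞
    (fun p => Bundle.TotalSpace.mk'
      (EuclideanSpace ℝ (Fin n) →L[ℝ] EuclideanSpace ℝ (Fin n) →L[ℝ] ℝ)
      (E := fun p : N => TangentSpace (𝓡 n) p →L[ℝ] TangentSpace (𝓡 n) p →L[ℝ] ℝ) p (ytensor p))
  ytensor_symm : ∀ (p : N) (u v : TangentSpace (𝓡 n) p), ytensor p u v = ytensor p v u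

namespace NullHypersurfaceData

variable {n : ℕ} {N : Type*} [TopologicalSpace N] [ChartedSpace (EuclideanSpace ℝ (Fin n)) N]
  [IsManifold (𝓡 n) ∞ N] (D : NullHypersurfaceData n N)

/-- The tensor field `Y`. -/
def Y : Tensor02Field n N := fun p => (D.ytensor p).toLinearMap₁₂

/-- `κ_n = -Y(n,n)`. -/
def κ : N → ℝ := fun p => - D.Y p (D.nvec p) (D.nvec p)

/-- `r = ι_n Y`. -/
def r : CovField n N := D.iotaN D.Y

/-- The constraint tensor
`ℛ_{ab} = Ric̊_{(ab)} - 2 £_n Y_{ab} - (2κ_n + tr_P U) Y_{ab} + ∇̊_{(a}(s_{b)} + 2 r_{b)})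
  - 2 r_a r_b + 4 r_{(a} s_{b)} - s_a s_b - (tr_P Y) U_{ab}
  + 2 P^{cd} U_{d(a}(2 Y_{b)c} + F_{b)c})`. -/
def constraintTensor : Tensor02Field n N := fun p =>
  symPart (ricci D.conn p) - (2 : ℝ) • lieTensor D.nvec D.Y p
    - (2 * D.κ p + D.trP D.U p) • D.Y p
    + symPart (nablaCov D.conn (fun q => D.s q + (2 : ℝ) • D.r q) p)
    - (2 : ℝ) • tensorProd (D.r p) (D.r p) + (4 : ℝ) • symProd (D.r p) (D.s p)
    - tensorProd (D.s p) (D.s p) - D.trP D.Y p • D.U p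
    + (2 : ℝ) • symPart (contractP (D.P p) (LinearMap.flip (D.U p))
        ((2 : ℝ) • D.Y p + D.F p))

/-- The covector field `Ŷ̄ = γ(Ȳ,·)` of the canonical decomposition of `Y`. -/
def w : CovField n N := D.barCov D.Y

/-- The component `Y^H` of `Y` in the kernel of the energy-momentum map. -/
def YH : Tensor02Field n N := D.partH D.Y

/-- The component `U^H` of `U` in the kernel of the energy-momentum map. -/
def UH : Tensor02Field n N := D.partH D.U

/-- The tensor field `(Ŷ̄ + s) ⊗ (Ŷ̄ + s)`. -/
def wsSq : Tensor02Field n N := fun p => tensorProd (D.w p + D.s p) (D.w p + D.s p)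

/-- The covector field `-2 £_n Ŷ̄ - 2 D κ_n + 4 κ_n s - 2 (tr_P U) Ŷ̄`. -/
def ellCoeff : CovField n N := fun p =>
  (-2 : ℝ) • lieCov D.nvec D.w p - (2 : ℝ) • D.Dop D.κ p + (4 * D.κ p) • D.s p
    - (2 * D.trP D.U p) • D.w p

/-- The function `n(κ_n ℓ⁽²⁾ - tr_P Y) + tr_P(∇̊Ŷ̄ - (Ŷ̄ + s) ⊗ (Ŷ̄ + s))
  + (κ_n ℓ⁽²⁾ - tr_P Y)(κ_n + tr_P U)`. -/
def gammaCoeff : N → ℝ := fun p =>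
  dd (fun q => D.κ q * D.ell2 q - D.trP D.Y q) p (D.nvec p)
    + D.trP (fun q => nablaCov D.conn D.w q - D.wsSq q) p
    + (D.κ p * D.ell2 p - D.trP D.Y p) * (D.κ p + D.trP D.U p)

end NullHypersurfaceData

end NullGeometry

end

/-!
The kernel of the energy-momentum map at a point consists of the symmetric tensors `T` with
`T(n,·) = 0` and `tr_P T = 0`; only the inclusion from right to left is needed (`mem_kernelTau`).
The projector `ℙ` is made so that `T - ℙ(T)` satisfies both conditions, because `γ(T̄,·)` is
`T(n,·) - T(n,n) ℓ`, `tr_P γ = n - 1` and `tr_P 𝒞 = 0`.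

For `Y^H = Y - ℙ(Y)` the operator `£̄_n` reduces to `£_n - 2 P^{cd} T_{c(a} U_{b)d}`. Expanding
`£_n Y^H` with the Leibniz rule, `£_n ℓ = 2s` and `£_n γ = 2U`, and expanding `∇̊_{(a} r_{b)}` with
`r = w - κ_n ℓ` and `∇̊_{(a} ℓ_{b)} = -ℓ⁽²⁾ U_{ab}`, turns the asserted identity into an identity
between polynomials in tensor components (`constraintTensor_eq`). The Ricci tensor enters both sides
in the same way, and nothing about curvature is used.

Kernel membership of `£̄_n Y^H` rests on the derivative of a trace along `n` (`trP_lieTensor`), and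
that of `𝒪(w)` on `∇̊_b n^a = P^{ac} U_{bc} + s_b n^a` (`nabla_nvec`).

Two facts make the operators meaningful. All fields are smooth, in particular `n` and `P` by Cramer's
rule in a local frame (`smoothNear_of_ambient`), so that `lieCov`, `lieTensor`, `extDerivCov` and
`nablaCov` are tensorial and take the expected values on smooth fields. The connection `∇̊` exists
(`exists_metricHypersurfaceConnection`): since its equations are algebraic at each point once a
torsion-free connection is given, it is obtained from an arbitrary one, without regularity.
-/

noncomputable section

namespace NullGeometry

open Filter Topology VectorField

/-! ### Smooth functions and vector fields -/

section Smooth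

variable {n : ℕ} {N : Type*} [TopologicalSpace N] [ChartedSpace (EuclideanSpace ℝ (Fin n)) N]

/-- The function `f` is smooth on a neighbourhood of `p`. -/
def SmoothFn (f : N → ℝ) (p : N) : Prop :=
  ∀ᶠ q in 𝓝 p, ContMDiffAt (𝓡 n) 𝓘(ℝ, ℝ) ∞ f q

/-- Differentiability of a function at a point. -/
abbrev FDiffAt (f : N → ℝ) (p : N) : Prop :=
  MDifferentiableAt (𝓡 n) 𝓘(ℝ, ℝ) f p

namespace SmoothFn

variable {f g : N → ℝ} {p : N}

lemma diff (h : SmoothFn (n := n) f p) : FDiffAt (n := n) f p :=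
  (Filter.Eventually.self_of_nhds h).mdifferentiableAt (by simp)

lemma const (c : ℝ) : SmoothFn (n := n) (fun _ : N => c) p :=
  .of_forall fun _ => contMDiffAt_const

lemma congr (h : SmoothFn (n := n) f p) (hfg : ∀ᶠ q in 𝓝 p, g q = f q) :
    SmoothFn (n := n) g p := by
  filter_upwards [h, hfg.eventually_nhds] with q hq hq'
  exact hq.congr_of_eventuallyEq hq'

lemma add (hf : SmoothFn (n := n) f p) (hg : SmoothFn (n := n) g p) :
    SmoothFn (n := n) (fun q => f q + g q) p := by
  filter_upwards [hf, hg] with q h₁ h₂ using h₁.add h₂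

lemma sub (hf : SmoothFn (n := n) f p) (hg : SmoothFn (n := n) g p) :
    SmoothFn (n := n) (fun q => f q - g q) p := by
  filter_upwards [hf, hg] with q h₁ h₂ using h₁.sub h₂

lemma mul (hf : SmoothFn (n := n) f p) (hg : SmoothFn (n := n) g p) :
    SmoothFn (n := n) (fun q => f q * g q) p := by
  filter_upwards [hf, hg] with q h₁ h₂ using h₁.mul h₂

lemma sum {ι : Type*} {s : Finset ι} {f : ι → N → ℝ}
    (hf : ∀ i ∈ s, SmoothFn (n := n) (f i) p) :
    SmoothFn (n := n) (fun q => ∑ i ∈ s, f i q) p := by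
  classical
  induction s using Finset.induction_on with
  | empty => simpa using const 0
  | insert a s ha ih =>
    simp only [Finset.sum_insert ha]
    exact (hf a (by simp)).add (ih fun i hi => hf i (by simp [hi]))

lemma prod {ι : Type*} {s : Finset ι} {f : ι → N → ℝ}
    (hf : ∀ i ∈ s, SmoothFn (n := n) (f i) p) :
    SmoothFn (n := n) (fun q => ∏ i ∈ s, f i q) p := by
  classical
  induction s using Finset.induction_on with
  | empty => simpa using const 1
  | insert a s ha ih =>
    simp only [Finset.prod_insert ha]
    exact (hf a (by simp)).mul (ih fun i hi => hf i (by simp [hi]))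

lemma div (hf : SmoothFn (n := n) f p) (hg : SmoothFn (n := n) g p)
    (h0 : ∀ᶠ q in 𝓝 p, g q ≠ 0) :
    SmoothFn (n := n) (fun q => f q / g q) p := by
  filter_upwards [hf, hg, h0] with q h₁ h₂ h₃ using h₁.div₀ h₂ h₃

lemma div_const (hf : SmoothFn (n := n) f p) (c : ℝ) :
    SmoothFn (n := n) (fun q => f q / c) p := by
  simpa only [div_eq_mul_inv] using hf.mul (const c⁻¹)

lemma det {ι : Type*} [Fintype ι] [DecidableEq ι] {M : N → Matrix ι ι ℝ}
    (hM : ∀ i j, SmoothFn (n := n) (fun q => M q i j) p) :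
    SmoothFn (n := n) (fun q => (M q).det) p := by
  simp only [Matrix.det_apply']
  exact sum fun σ _ => (const _).mul (prod fun i _ => hM _ _)

end SmoothFn

section dd

variable {f g : N → ℝ} {p : N}

lemma dd_add (hf : FDiffAt (n := n) f p) (hg : FDiffAt (n := n) g p)
    (v : TangentSpace (𝓡 n) p) :
    dd (fun q => f q + g q) p v = dd f p v + dd g p v := by
  have := mvfderiv_add hf hg
  exact congrArg (fun L => L v) this

lemma dd_sub (hf : FDiffAt (n := n) f p) (hg : FDiffAt (n := n) g p)
    (v : TangentSpace (𝓡 n) p) :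
    dd (fun q => f q - g q) p v = dd f p v - dd g p v := by
  have := mvfderiv_sub hf hg
  exact congrArg (fun L => L v) this

lemma dd_mul (hf : FDiffAt (n := n) f p) (hg : FDiffAt (n := n) g p)
    (v : TangentSpace (𝓡 n) p) :
    dd (fun q => f q * g q) p v = dd f p v * g p + f p * dd g p v := by
  have := mvfderiv_mul hf hg
  have h := congrArg (fun L => L v) this
  refine h.trans ?_
  simp [dd, mul_comm, add_comm]

lemma dd_const (c : ℝ) (v : TangentSpace (𝓡 n) p) : dd (fun _ : N => c) p v = 0 := by
  simp [dd, mvfderiv_const]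

lemma dd_congr (h : ∀ᶠ q in 𝓝 p, f q = g q) (v : TangentSpace (𝓡 n) p) :
    dd f p v = dd g p v := by
  have h : f =ᶠ[𝓝 p] g := h
  simp only [dd, mvfderiv, h.mfderiv_eq]
  rfl

lemma dd_sum {ι : Type*} {s : Finset ι} {f : ι → N → ℝ}
    (hf : ∀ i ∈ s, SmoothFn (n := n) (f i) p) (v : TangentSpace (𝓡 n) p) :
    dd (fun q => ∑ i ∈ s, f i q) p v = ∑ i ∈ s, dd (f i) p v := by
  classical
  induction s using Finset.induction_on with
  | empty => simpa using dd_const 0 v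
  | insert a s ha ih =>
    simp only [Finset.sum_insert ha]
    have h := fun i hi => hf i (Finset.mem_insert_of_mem hi)
    rw [dd_add (hf a (by simp)).diff (SmoothFn.sum h).diff, ih h]

lemma dd_div_const (hf : SmoothFn (n := n) f p) (c : ℝ)
    (v : TangentSpace (𝓡 n) p) : dd (fun q => f q / c) p v = dd f p v / c := by
  simp only [div_eq_mul_inv]
  rw [dd_mul hf.diff (SmoothFn.const c⁻¹).diff, dd_const]
  ring

end dd

variable {p : N} {X Z W : VField n N} {f g : N → ℝ}

lemma bracket_self : bracket X X p = 0 := by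
  simp [bracket]

variable [IsManifold (𝓡 n) ∞ N]

/-- Differentiability of a vector field at a point, as a section of the tangent bundle. -/
abbrev VDiffAt (X : VField n N) (p : N) : Prop :=
  MDifferentiableAt (𝓡 n) (𝓡 n).tangent (fun q => (⟨q, X q⟩ : TangentBundle (𝓡 n) N)) p

lemma isManifold_minSmoothness : IsManifold (𝓡 n) (minSmoothness ℝ 2) N := by
  rw [minSmoothness_of_isRCLikeNormedField]; infer_instance

namespace SmoothNear

lemma diff (h : SmoothNear X p) : VDiffAt X p :=
  (Filter.Eventually.self_of_nhds h).mdifferentiableAt (by simp)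

lemma eventually (h : SmoothNear X p) : ∀ᶠ q in 𝓝 p, SmoothNear X q :=
  Filter.Eventually.eventually_nhds h

lemma congr (h : SmoothNear X p) (hXZ : ∀ᶠ q in 𝓝 p, Z q = X q) : SmoothNear Z p := by
  filter_upwards [h, hXZ.eventually_nhds] with q hq hq'
  refine hq.congr_of_eventuallyEq ?_
  filter_upwards [hq'] with r hr
  rw [hr]

lemma sub (hX : SmoothNear X p) (hZ : SmoothNear Z p) :
    SmoothNear (fun q => X q - Z q) p := by
  filter_upwards [hX, hZ] with q h₁ h₂ using h₁.sub_section h₂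

lemma smul (hf : SmoothFn (n := n) f p) (hX : SmoothNear X p) :
    SmoothNear (fun q => f q • X q) p := by
  filter_upwards [hf, hX] with q h₁ h₂ using h₁.smul_section h₂

lemma sum {ι : Type*} {s : Finset ι} {X : ι → VField n N} (hX : ∀ i ∈ s, SmoothNear (X i) p) :
    SmoothNear (fun q => ∑ i ∈ s, X i q) p := by
  have : ∀ᶠ q in 𝓝 p, ∀ i ∈ s, ContMDiffAt (𝓡 n) (𝓡 n).tangent ∞
    (fun q' => (⟨q', X i q'⟩ : TangentBundle (𝓡 n) N)) q :=
    (Filter.eventually_all_finset s).2 hX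
  filter_upwards [this] with q h using ContMDiffAt.sum_section h

end SmoothNear

/-- An extension of a tangent vector to a vector field, smooth near its base point: constant in the
preferred trivialization. -/
abbrev ext {p : N} (v : TangentSpace (𝓡 n) p) : VField n N :=
  FiberBundle.extend (EuclideanSpace ℝ (Fin n)) v

lemma ext_self (v : TangentSpace (𝓡 n) p) : ext v p = v := by simp [ext]

lemma smoothNear_ext (v : TangentSpace (𝓡 n) p) : SmoothNear (ext v) p := by
  obtain ⟨s, hs, h⟩ :=
    FiberBundle.exists_contMDiffOn_extend (k := ∞) (𝓡 n) (EuclideanSpace ℝ (Fin n)) v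
  filter_upwards [eventually_mem_nhds_iff.2 hs] with q hq using h.contMDiffAt hq

lemma SmoothNear.bracket (hX : SmoothNear X p) (hZ : SmoothNear Z p) :
    SmoothNear (bracket X Z) p := by
  have : IsManifold (𝓡 n) (minSmoothness ℝ 2) N := isManifold_minSmoothness
  have : IsManifold (𝓡 n) (((⊤ : ℕ∞) : WithTop ℕ∞) + 1) N := ‹IsManifold (𝓡 n) ∞ N›
  filter_upwards [hX, hZ] with q h₁ h₂
  exact ContMDiffAt.mlieBracket_vectorField (m := ⊤) (n := ⊤) h₁ h₂ (by simp)

lemma bracket_add (hZ : VDiffAt Z p) (hW : VDiffAt W p) :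
    bracket X (fun q => Z q + W q) p = bracket X Z p + bracket X W p :=
  mlieBracket_add_right hZ hW

lemma bracket_smul (hf : FDiffAt (n := n) f p) (hZ : VDiffAt Z p) :
    bracket X (fun q => f q • Z q) p = dd f p (X p) • Z p + f p • bracket X Z p :=
  mlieBracket_smul_right hf hZ

/-- `X(f)` is smooth when `X` and `f` are. -/
lemma SmoothFn.dd_apply (hf : SmoothFn (n := n) f p) (hX : SmoothNear X p) :
    SmoothFn (n := n) (fun q => dd f q (X q)) p := by
  filter_upwards [hf, hX] with q h₁ h₂
  have h := ContMDiffAt.clm_apply_of_inCoordinates (h₁.mfderiv_const (m := ∞) (by simp)) h₂ h₁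
  rw [Bundle.contMDiffAt_totalSpace] at h
  simp only [trivializationAt_model_space_apply] at h
  exact h.2

end Smooth

/-! ### Local frames and tensoriality -/

section Frames

variable {n : ℕ} {N : Type*} [TopologicalSpace N] [ChartedSpace (EuclideanSpace ℝ (Fin n)) N]
  [IsManifold (𝓡 n) ∞ N]

/-- A smooth local frame of the tangent bundle near `p`, with its dual coframe. The fields are
defined everywhere, but only their germs at `p` are constrained. -/
structure LocalFrame (p : N) where
  /-- the vector fields of the frame -/
  vec : Fin n → VField n N
  /-- the dual coframe -/
  coeff : Fin n → CovField n N
  smooth_vec : ∀ i, SmoothNear (vec i) p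
  smooth_coeff : ∀ i X, SmoothNear X p → SmoothFn (n := n) (fun q => coeff i q (X q)) p
  diff_coeff : ∀ i X, VDiffAt X p → FDiffAt (n := n) (fun q => coeff i q (X q)) p
  sum_eq : ∀ᶠ q in 𝓝 p, ∀ v : TangentSpace (𝓡 n) q, ∑ i, coeff i q v • vec i q = v
  coeff_vec : ∀ᶠ q in 𝓝 p, ∀ i j, coeff i q (vec j q) = if i = j then 1 else 0

/-- The frame of the preferred trivialization at `p` given by the standard basis of `ℝⁿ`. -/
def localFrameAt (p : N) : LocalFrame (n := n) p :=
  let b := (EuclideanSpace.basisFun (Fin n) ℝ).toBasis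
  let t := trivializationAt (EuclideanSpace ℝ (Fin n)) (TangentSpace (𝓡 n)) p
  have hp : p ∈ t.baseSet := FiberBundle.mem_baseSet_trivializationAt' p
  have hnhds : ∀ᶠ q in 𝓝 p, q ∈ t.baseSet := t.open_baseSet.mem_nhds hp
  { vec := t.localFrame b
    coeff := t.localFrameCoeff (𝓡 n) b
    smooth_vec := fun i => by
      filter_upwards [hnhds] with q hq
      exact contMDiffAt_localFrame_of_mem ∞ _ b i hq
    smooth_coeff := fun i X hX => by
      filter_upwards [hnhds, hX] with q hq hX
      exact contMDiffAt_localFrameCoeff b hq hX i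
    diff_coeff := fun i X hX =>
      mdifferentiableAt_localFrameCoeff b hp hX i
    sum_eq := by
      filter_upwards [hnhds] with q hq v
      have := t.eq_sum_localFrameCoeff_smul (I := 𝓡 n) (b := b) (s := ext v) (hx := hq)
      rw [ext_self] at this
      exact this.symm
    coeff_vec := by
      filter_upwards [hnhds] with q hq i j
      rw [t.localFrameCoeff_apply_of_mem_baseSet (I := 𝓡 n) b hq (t.localFrame b j) i,
        t.localFrame_apply_of_mem_baseSet b hq, Module.Basis.repr_self, Finsupp.single_apply]
      simp only [eq_comm] }

variable {p : N}

/-- The covector field `θ` is smooth near `p`. -/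
def SmoothCov (θ : CovField n N) (p : N) : Prop :=
  ∀ X, SmoothNear X p → SmoothFn (n := n) (fun q => θ q (X q)) p

/-- The `(0,2)`-tensor field `T` is smooth near `p`. -/
def SmoothTen (T : Tensor02Field n N) (p : N) : Prop :=
  ∀ X Z, SmoothNear X p → SmoothNear Z p → SmoothFn (n := n) (fun q => T q (X q) (Z q)) p

variable {θ η : CovField n N} {S T : Tensor02Field n N} {f : N → ℝ} {X Z W : VField n N}

/-- A smooth covector field takes differentiable values on vector fields that are merely
differentiable at `p`; Mathlib's tensoriality criterion requires this. -/
lemma SmoothCov.diff (h : SmoothCov θ p) (hX : VDiffAt X p) :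
    FDiffAt (n := n) (fun q => θ q (X q)) p := by
  let e := localFrameAt (n := n) p
  have h1 : (fun q => θ q (X q)) =ᶠ[𝓝 p] fun q => ∑ i, e.coeff i q (X q) * θ q (e.vec i q) := by
    filter_upwards [e.sum_eq] with q hq
    conv_lhs => rw [← hq (X q)]
    simp
  refine MDifferentiableAt.congr_of_eventuallyEq ?_ h1
  have := fun i (_ : i ∈ Finset.univ) => (e.diff_coeff i X hX).mul (h _ (e.smooth_vec i)).diff
  exact (MDifferentiableAt.sum this).congr_of_eventuallyEq (.of_eq (by ext q; simp))

lemma SmoothTen.apply (h : SmoothTen T p) (hX : SmoothNear X p) :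
    SmoothCov (fun q => T q (X q)) p := fun Z hZ => h X Z hX hZ

lemma SmoothTen.diff (h : SmoothTen T p) (hX : VDiffAt X p) (hZ : VDiffAt Z p) :
    FDiffAt (n := n) (fun q => T q (X q) (Z q)) p := by
  let e := localFrameAt (n := n) p
  have h1 : (fun q => T q (X q) (Z q)) =ᶠ[𝓝 p]
      fun q => ∑ i, e.coeff i q (X q) * T q (e.vec i q) (Z q) := by
    filter_upwards [e.sum_eq] with q hq
    conv_lhs => rw [← hq (X q)]
    simp
  refine MDifferentiableAt.congr_of_eventuallyEq ?_ h1
  have := fun i (_ : i ∈ Finset.univ) => (e.diff_coeff i X hX).mul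
    ((h.apply (e.smooth_vec i)).diff hZ)
  exact (MDifferentiableAt.sum this).congr_of_eventuallyEq (.of_eq (by ext q; simp))

lemma SmoothCov.add (h : SmoothCov θ p) (h' : SmoothCov η p) :
    SmoothCov (fun q => θ q + η q) p := fun X hX => (h X hX).add (h' X hX)

lemma SmoothCov.sub (h : SmoothCov θ p) (h' : SmoothCov η p) :
    SmoothCov (fun q => θ q - η q) p := fun X hX => (h X hX).sub (h' X hX)

lemma SmoothCov.smul (hf : SmoothFn (n := n) f p) (h : SmoothCov θ p) :
    SmoothCov (fun q => f q • θ q) p := fun X hX => hf.mul (h X hX)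

lemma SmoothTen.add (h : SmoothTen S p) (h' : SmoothTen T p) :
    SmoothTen (fun q => S q + T q) p := fun X Z hX hZ => (h X Z hX hZ).add (h' X Z hX hZ)

lemma SmoothTen.sub (h : SmoothTen S p) (h' : SmoothTen T p) :
    SmoothTen (fun q => S q - T q) p := fun X Z hX hZ => (h X Z hX hZ).sub (h' X Z hX hZ)

lemma SmoothTen.smul (hf : SmoothFn (n := n) f p) (h : SmoothTen T p) :
    SmoothTen (fun q => f q • T q) p := fun X Z hX hZ => hf.mul (h X Z hX hZ)

lemma SmoothCov.tensorProd (h : SmoothCov θ p) (h' : SmoothCov η p) :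
    SmoothTen (fun q => tensorProd (θ q) (η q)) p :=
  fun X Z hX hZ => (h X hX).mul (h' Z hZ)

lemma SmoothTen.symPart (h : SmoothTen T p) : SmoothTen (fun q => symPart (T q)) p :=
  fun X Z hX hZ => (SmoothFn.const (1 / 2)).mul ((h X Z hX hZ).add (h Z X hZ hX))

lemma SmoothCov.symProd (h : SmoothCov θ p) (h' : SmoothCov η p) :
    SmoothTen (fun q => symProd (θ q) (η q)) p := (h.tensorProd h').symPart

/-- A vector field is smooth as soon as its frame coefficients are. -/
lemma SmoothNear.of_coeff (e : LocalFrame (n := n) p) {f : Fin n → N → ℝ}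
    (hf : ∀ i, SmoothFn (n := n) (f i) p) (h : ∀ᶠ q in 𝓝 p, X q = ∑ i, f i q • e.vec i q) :
    SmoothNear X p :=
  (SmoothNear.sum fun i (_ : i ∈ Finset.univ) =>
    SmoothNear.smul (hf i) (e.smooth_vec i)).congr h

/-- An operation that satisfies Mathlib's tensoriality criterion is represented by `linearAt`. -/
lemma linearAt_apply {Φ : VField n N → ℝ}
    (h : TensorialAt (𝓡 n) (EuclideanSpace ℝ (Fin n)) Φ p) (hX : SmoothNear X p) :
    linearAt p Φ (X p) = Φ X := by
  have hex : ∃ L : TangentSpace (𝓡 n) p →ₗ[ℝ] ℝ,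
      ∀ X : VField n N, SmoothNear X p → L (X p) = Φ X :=
    ⟨(TensorialAt.mkHom Φ p h).toLinearMap, fun X hX => TensorialAt.mkHom_apply h hX.diff⟩
  rw [linearAt, dif_pos hex]
  exact hex.choose_spec X hX

/-- An operation that satisfies Mathlib's tensoriality criterion in each argument is represented by
`tensorAt`, so the junk value `0` does not occur. -/
lemma tensorAt_apply {Φ : VField n N → VField n N → ℝ}
    (h₁ : ∀ Z, VDiffAt Z p → TensorialAt (𝓡 n) (EuclideanSpace ℝ (Fin n)) (Φ · Z) p)
    (h₂ : ∀ X, VDiffAt X p → TensorialAt (𝓡 n) (EuclideanSpace ℝ (Fin n)) (Φ X ·) p)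
    (hX : SmoothNear X p) (hZ : SmoothNear Z p) :
    tensorAt p Φ (X p) (Z p) = Φ X Z := by
  have hex : ∃ B : LinearMap.BilinForm ℝ (TangentSpace (𝓡 n) p),
      ∀ X Z : VField n N, SmoothNear X p → SmoothNear Z p → B (X p) (Z p) = Φ X Z :=
    ⟨(TensorialAt.mkHom₂ Φ p h₁ h₂).toLinearMap₁₂,
      fun X Z hX hZ => TensorialAt.mkHom₂_apply h₁ h₂ hX.diff hZ.diff⟩
  rw [tensorAt, dif_pos hex]
  exact hex.choose_spec X Z hX hZ

lemma cov_ext {α β : Dual ℝ (TangentSpace (𝓡 n) p)}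
    (h : ∀ X : VField n N, SmoothNear X p → α (X p) = β (X p)) : α = β := by
  ext v
  simpa using h (ext v) (smoothNear_ext v)

lemma ten_ext {A B : LinearMap.BilinForm ℝ (TangentSpace (𝓡 n) p)}
    (h : ∀ X Z : VField n N, SmoothNear X p → SmoothNear Z p → A (X p) (Z p) = B (X p) (Z p)) :
    A = B := by
  ext u v
  simpa using h (ext u) (ext v) (smoothNear_ext u) (smoothNear_ext v)

lemma lieCov_apply (hθ : SmoothCov θ p) (hZ : SmoothNear Z p) :
    lieCov X θ p (Z p) = dd (fun q => θ q (Z q)) p (X p) - θ p (bracket X Z p) := by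
  refine linearAt_apply (Φ := fun Z => dd (fun q => θ q (Z q)) p (X p) - θ p (bracket X Z p))
    ⟨fun {f Z} hf hZ => ?_, fun {Z W} hZ hW => ?_⟩ hZ
  · have h1 := dd_mul hf (hθ.diff hZ) (X p)
    have h2 := bracket_smul (X := X) hf hZ
    simp only [Pi.smul_apply', map_smul, smul_eq_mul]
    refine (congrArg₂ (· - ·) h1 (congrArg (θ p) h2)).trans ?_
    simp
    ring
  · have h1 := dd_add (hθ.diff hZ) (hθ.diff hW) (X p)
    have h2 := bracket_add (X := X) hZ hW
    simp only [Pi.add_apply, map_add]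
    refine (congrArg₂ (· - ·) h1 (congrArg (θ p) h2)).trans ?_
    simp
    ring

lemma lieTensor_apply (hT : SmoothTen T p) (hZ : SmoothNear Z p) (hW : SmoothNear W p) :
    lieTensor X T p (Z p) (W p) = dd (fun q => T q (Z q) (W q)) p (X p)
      - T p (bracket X Z p) (W p) - T p (Z p) (bracket X W p) := by
  refine tensorAt_apply (Φ := fun Z W => dd (fun q => T q (Z q) (W q)) p (X p)
      - T p (bracket X Z p) (W p) - T p (Z p) (bracket X W p))
    (fun W hW => ⟨fun {f Z} hf hZ => ?_, fun {Z Z'} hZ hZ' => ?_⟩)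
    (fun Z hZ => ⟨fun {f W} hf hW => ?_, fun {W W'} hW hW' => ?_⟩) hZ hW
  · have h1 := dd_mul hf (hT.diff hZ hW) (X p)
    have h2 : bracket X (f • Z) p = _ := bracket_smul (X := X) hf hZ
    simp only [Pi.smul_apply', map_smul, smul_eq_mul, h2, h1, LinearMap.smul_apply, map_add,
      LinearMap.add_apply]
    ring
  · have h1 := dd_add (hT.diff hZ hW) (hT.diff hZ' hW) (X p)
    have h2 : bracket X (Z + Z') p = _ := bracket_add (X := X) hZ hZ'
    simp only [Pi.add_apply, map_add, h2, h1, LinearMap.add_apply]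
    ring
  · have h1 := dd_mul hf (hT.diff hZ hW) (X p)
    have h2 : bracket X (f • W) p = _ := bracket_smul (X := X) hf hW
    simp only [Pi.smul_apply', map_smul, smul_eq_mul, h2, h1, map_add]
    ring
  · have h1 := dd_add (hT.diff hZ hW) (hT.diff hZ hW') (X p)
    have h2 : bracket X (W + W') p = _ := bracket_add (X := X) hW hW'
    simp only [Pi.add_apply, map_add, h2, h1]
    ring

lemma bracket_add_left (hZ : VDiffAt Z p) (hW : VDiffAt W p) :
    bracket (fun q => Z q + W q) X p = bracket Z X p + bracket W X p :=
  mlieBracket_add_left hZ hW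

lemma bracket_smul_left (hf : FDiffAt (n := n) f p) (hZ : VDiffAt Z p) :
    bracket (fun q => f q • Z q) X p = - dd f p (X p) • Z p + f p • bracket Z X p :=
  mlieBracket_smul_left hf hZ

lemma extDerivCov_apply (hθ : SmoothCov θ p) (hX : SmoothNear X p) (hZ : SmoothNear Z p) :
    extDerivCov θ p (X p) (Z p) = dd (fun q => θ q (Z q)) p (X p)
      - dd (fun q => θ q (X q)) p (Z p) - θ p (bracket X Z p) := by
  refine tensorAt_apply (Φ := fun X Z => dd (fun q => θ q (Z q)) p (X p)
      - dd (fun q => θ q (X q)) p (Z p) - θ p (bracket X Z p))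
    (fun W hW => ⟨fun {f Z} hf hZ => ?_, fun {Z Z'} hZ hZ' => ?_⟩)
    (fun Z hZ => ⟨fun {f W} hf hW => ?_, fun {W W'} hW hW' => ?_⟩) hX hZ
  · have h1 := dd_mul hf (hθ.diff hZ) (W p)
    have h2 : bracket (f • Z) W p = _ := bracket_smul_left (X := W) hf hZ
    simp only [Pi.smul_apply', map_smul, smul_eq_mul, h2, h1, map_add]
    ring
  · have h1 := dd_add (hθ.diff hZ) (hθ.diff hZ') (W p)
    have h2 : bracket (Z + Z') W p = _ := bracket_add_left (X := W) hZ hZ'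
    simp only [Pi.add_apply, map_add, h2, h1]
    ring
  · have h1 := dd_mul hf (hθ.diff hW) (Z p)
    have h2 : bracket Z (f • W) p = _ := bracket_smul (X := Z) hf hW
    simp only [Pi.smul_apply', map_smul, smul_eq_mul, h2, h1, map_add]
    ring
  · have h1 := dd_add (hθ.diff hW) (hθ.diff hW') (Z p)
    have h2 : bracket Z (W + W') p = _ := bracket_add (X := Z) hW hW'
    simp only [Pi.add_apply, map_add, h2, h1]
    ring

variable (cov : CovariantDerivative (𝓡 n) (EuclideanSpace ℝ (Fin n))
      (TangentSpace (𝓡 n) : N → Type _))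

lemma cov_add (v : TangentSpace (𝓡 n) p) (hZ : VDiffAt Z p) (hW : VDiffAt W p) :
    cov.toFun (fun q => Z q + W q) p v = cov.toFun Z p v + cov.toFun W p v :=
  congrArg (fun L => L v) (cov.isCovariantDerivativeOnUniv.add hZ hW)

lemma cov_smul (v : TangentSpace (𝓡 n) p) (hf : FDiffAt (n := n) f p) (hZ : VDiffAt Z p) :
    cov.toFun (fun q => f q • Z q) p v = f p • cov.toFun Z p v + dd f p v • Z p :=
  congrArg (fun L => L v) (cov.isCovariantDerivativeOnUniv.leibniz hZ hf)

lemma nablaCov_apply (hθ : SmoothCov θ p) (hX : SmoothNear X p) (hZ : SmoothNear Z p) :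
    nablaCov cov.toFun θ p (X p) (Z p) = dd (fun q => θ q (Z q)) p (X p)
      - θ p (cov.toFun Z p (X p)) := by
  refine tensorAt_apply (Φ := fun X Z => dd (fun q => θ q (Z q)) p (X p)
      - θ p (covDeriv cov.toFun X Z p))
    (fun W hW => ⟨fun {f Z} hf hZ => ?_, fun {Z Z'} hZ hZ' => ?_⟩)
    (fun Z hZ => ⟨fun {f W} hf hW => ?_, fun {W W'} hW hW' => ?_⟩) hX hZ
  · simp only [Pi.smul_apply', map_smul, smul_eq_mul, covDeriv]
    ring
  · simp only [Pi.add_apply, map_add, covDeriv]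
    ring
  · have h1 := dd_mul hf (hθ.diff hW) (Z p)
    have h2 : cov.toFun (f • W) p _ = _ := cov_smul cov (Z p) hf hW
    simp only [Pi.smul_apply', map_smul, smul_eq_mul, covDeriv, h2, h1, map_add]
    ring
  · have h1 := dd_add (hθ.diff hW) (hθ.diff hW') (Z p)
    have h2 : cov.toFun (W + W') p _ = _ := cov_add cov (Z p) hW hW'
    simp only [Pi.add_apply, map_add, h2, h1, covDeriv]
    ring

/-- The exterior derivative of a smooth covector field is smooth. -/
lemma SmoothCov.extDeriv (hθ : ∀ q, SmoothCov θ q) : SmoothTen (extDerivCov θ) p := by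
  intro Z W hZ hW
  have h : SmoothFn (n := n) (fun q => dd (fun q => θ q (W q)) q (Z q)
      - dd (fun q => θ q (Z q)) q (W q) - θ q (bracket Z W q)) p :=
    (((hθ p W hW).dd_apply hZ).sub ((hθ p Z hZ).dd_apply hW)).sub (hθ p _ (hZ.bracket hW))
  refine h.congr ?_
  filter_upwards [hZ.eventually, hW.eventually] with q h₁ h₂
  exact extDerivCov_apply (hθ q) h₁ h₂

end Frames

/-! ### Algebra of a degenerate metric -/

section Algebra

variable {V : Type*} [AddCommGroup V] [Module ℝ V]

@[simp] lemma tensorProd_apply (α β : Dual ℝ V) (u v : V) :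
    tensorProd α β u v = α u * β v := rfl

@[simp] lemma symPart_apply (T : LinearMap.BilinForm ℝ V) (u v : V) :
    symPart T u v = 1 / 2 * (T u v + T v u) := rfl

@[simp] lemma symProd_apply (α β : Dual ℝ V) (u v : V) :
    symProd α β u v = 1 / 2 * (α u * β v + α v * β u) := rfl

@[simp] lemma contractP_apply (P : Dual ℝ V →ₗ[ℝ] V) (S T : LinearMap.BilinForm ℝ V) (u v : V) :
    contractP P S T u v = S u (P (T v)) := rfl

/-- The algebraic relations between a degenerate metric `g`, a covector `l`, a number `c`, and the
objects `n` and `P` obtained by inverting the form `ambientForm g l c`. -/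
structure IsNullFrame (g : LinearMap.BilinForm ℝ V) (l : Dual ℝ V) (c : ℝ) (n : V)
    (P : Dual ℝ V →ₗ[ℝ] V) : Prop where
  g_symm : ∀ u v, g u v = g v u
  g_n : g n = 0
  l_n : l n = 1
  g_P : ∀ θ, g (P θ) = θ - θ n • l
  l_P : ∀ θ, l (P θ) = -c * θ n
  eq_zero : ∀ v, g v = 0 → l v = 0 → v = 0

namespace IsNullFrame

variable {g : LinearMap.BilinForm ℝ V} {l : Dual ℝ V} {c : ℝ} {n : V} {P : Dual ℝ V →ₗ[ℝ] V}
  (h : IsNullFrame g l c n P)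

include h

/-- A vector is determined by its metric dual and its value under `l`. -/
lemma eq_of (v w : V) (h₁ : g v = g w) (h₂ : l v = l w) : v = w :=
  sub_eq_zero.1 (h.eq_zero _ (by simp [h₁]) (by simp [h₂]))

lemma g_n_right (u : V) : g u n = 0 := by rw [h.g_symm, h.g_n]; rfl

lemma P_g (v : V) : P (g v) = v - l v • n :=
  h.eq_of _ _ (by simp [h.g_P, h.g_n, h.g_n_right]) (by simp [h.l_P, h.l_n, h.g_n_right])

lemma eq_P_add (v : V) : v = P (g v) + l v • n := by rw [h.P_g]; simp

lemma P_symm (α β : Dual ℝ V) : α (P β) = β (P α) := by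
  have h1 := congrArg (fun θ => θ (P β)) (h.g_P α)
  have h2 := congrArg (fun θ => θ (P α)) (h.g_P β)
  simp only [LinearMap.sub_apply, LinearMap.smul_apply, smul_eq_mul, h.l_P] at h1 h2
  linear_combination h2 - h1 + h.g_symm (P α) (P β)

end IsNullFrame

section

variable (P : Dual ℝ V →ₗ[ℝ] V) (S T : LinearMap.BilinForm ℝ V)

lemma traceP_add : traceP P (S + T) = traceP P S + traceP P T := by
  simp [traceP, LinearMap.comp_add]

lemma traceP_sub : traceP P (S - T) = traceP P S - traceP P T := by
  simp [traceP, LinearMap.comp_sub]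

lemma traceP_smul (a : ℝ) : traceP P (a • T) = a * traceP P T := by
  simp [traceP, LinearMap.comp_smul]

end

variable [FiniteDimensional ℝ V]

lemma trace_eq_sum {ι : Type*} [Fintype ι] {e : ι → V} {c : ι → Dual ℝ V}
    (hec : ∀ v, ∑ i, c i v • e i = v) (A : V →ₗ[ℝ] V) :
    LinearMap.trace ℝ V A = ∑ i, c i (A (e i)) := by
  have : A = ∑ i, (c i).smulRight (A (e i)) := by
    ext v
    conv_lhs => rw [← hec v]
    simp
  conv_lhs => rw [this]
  simp [LinearMap.trace_smulRight]

variable (P : Dual ℝ V →ₗ[ℝ] V) (T : LinearMap.BilinForm ℝ V)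

lemma traceP_tensorProd (α β : Dual ℝ V) : traceP P (tensorProd α β) = α (P β) := by
  have : P ∘ₗ tensorProd α β = α.smulRight (P β) := by
    ext v
    have : tensorProd α β v = α v • β := rfl
    simp [this]
  rw [traceP, this, LinearMap.trace_smulRight]

namespace IsNullFrame

variable {g : LinearMap.BilinForm ℝ V} {l : Dual ℝ V} {c : ℝ} {n : V} {P : Dual ℝ V →ₗ[ℝ] V}
  (h : IsNullFrame g l c n P)

include h

/-- Symmetry of `P` makes the trace blind to transposition: the transpose of `P ∘ T` is
`Tᵗ ∘ P`. -/
lemma traceP_flip : traceP P (LinearMap.flip T) = traceP P T := by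
  have h1 : Module.Dual.transpose (R := ℝ) (P ∘ₗ T) = LinearMap.flip T ∘ₗ P := by
    ext θ v
    simp [Module.Dual.transpose_apply, h.P_symm θ]
  rw [traceP, LinearMap.trace_comp_comm', ← h1, LinearMap.trace_transpose', traceP]

lemma traceP_symPart : traceP P (symPart T) = traceP P T := by
  rw [symPart, traceP_smul, traceP_add, h.traceP_flip]; ring

lemma traceP_symProd (α β : Dual ℝ V) : traceP P (symProd α β) = α (P β) := by
  rw [symProd, h.traceP_symPart, traceP_tensorProd]

lemma traceP_g : traceP P g = (Module.finrank ℝ V : ℝ) - 1 := by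
  have : P ∘ₗ g = LinearMap.id - l.smulRight n := by
    ext v
    simp [h.P_g]
  rw [traceP, this, map_sub, LinearMap.trace_smulRight, h.l_n, LinearMap.trace_id]

end IsNullFrame

end Algebra

/-! ### Algebra of null metric hypersurface data -/

variable {n : ℕ} {N : Type*} [TopologicalSpace N] [ChartedSpace (EuclideanSpace ℝ (Fin n)) N]

lemma finiteDimensional_tangentSpace (p : N) :
    FiniteDimensional ℝ (TangentSpace (𝓡 n) p) :=
  inferInstanceAs (FiniteDimensional ℝ (EuclideanSpace ℝ (Fin n)))

lemma finrank_tangentSpace (p : N) : Module.finrank ℝ (TangentSpace (𝓡 n) p) = n :=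
  finrank_euclideanSpace_fin (𝕜 := ℝ) (n := n)

namespace NullMetricHypersurfaceData

variable [IsManifold (𝓡 n) ∞ N] (D : NullMetricHypersurfaceData n N) (p : N)

lemma ambient_apply (x y : TangentSpace (𝓡 n) p × ℝ) :
    D.ambientEquiv p x y
      = D.γ p x.1 y.1 + x.2 * D.ℓ p y.1 + y.2 * D.ℓ p x.1 + x.2 * y.2 * D.ell2 p := by
  have : FiniteDimensional ℝ (TangentSpace (𝓡 n) p) := finiteDimensional_tangentSpace p
  exact LinearMap.BilinForm.toDual_def (D.ambient_nondegenerate p)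

lemma exists_radical : ∃ m : TangentSpace (𝓡 n) p, D.γ p m = 0 ∧ D.ℓ p m ≠ 0 := by
  obtain ⟨⟨m, hm⟩, hm0, -⟩ := finrank_eq_one_iff'.1 (D.radical_finrank p)
  have hm : D.γ p m = 0 := hm
  refine ⟨m, hm, fun hl => hm0 ?_⟩
  have : ((m, 0) : TangentSpace (𝓡 n) p × ℝ) = 0 := by
    apply (D.ambientEquiv p).injective
    ext y <;> simp [ambient_apply, hm, hl]
  simpa using congrArg Prod.fst this

/-- The `ℝ`-component of `𝒜♯(0,1)` vanishes, as one sees by pairing with the radical of `γ`; hence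
`n` spans that radical and is normalized by `ℓ`. -/
lemma nvec_aux : D.γ p (D.nvec p) = 0 ∧ D.ℓ p (D.nvec p) = 1 := by
  obtain ⟨m, hm, hl⟩ := D.exists_radical p
  set x := (D.ambientEquiv p).symm (LinearMap.snd ℝ _ _) with hx
  have key : ∀ y, D.ambientEquiv p x y = y.2 := fun y => by rw [hx]; simp
  have hn : D.nvec p = x.1 := rfl
  have hsym : ∀ u v, D.γ p u v = D.γ p v u := D.metric_symm p
  have h2 : x.2 = 0 := by
    have := key (m, 0)
    rw [ambient_apply] at this
    simp [hsym x.1 m, hm, hl] at this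
    exact this
  rw [hn]
  constructor
  · ext u
    have := key (u, 0)
    rw [ambient_apply] at this
    simpa [h2] using this
  · have := key (0, 1)
    rw [ambient_apply] at this
    simpa [h2] using this

lemma isNullFrame : IsNullFrame (D.γ p) (D.ℓ p) (D.ell2 p) (D.nvec p) (D.P p) := by
  have hsym : ∀ u v, D.γ p u v = D.γ p v u := D.metric_symm p
  obtain ⟨hn, hl⟩ := D.nvec_aux p
  have key : ∀ θ, D.γ p (D.P p θ) = θ - θ (D.nvec p) • D.ℓ p ∧
      D.ℓ p (D.P p θ) = - D.ell2 p * θ (D.nvec p) := by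
    intro θ
    set x := (D.ambientEquiv p).symm ((LinearMap.fst ℝ (TangentSpace (𝓡 n) p) ℝ).dualMap θ)
      with hx
    have key : ∀ y, D.ambientEquiv p x y = θ y.1 := fun y => by rw [hx]; simp
    have hP : D.P p θ = x.1 := rfl
    have h2 : x.2 = θ (D.nvec p) := by
      have := key (D.nvec p, 0)
      rw [ambient_apply] at this
      simpa [hsym x.1 (D.nvec p), hn, hl] using this
    rw [hP]
    constructor
    · ext u
      have := key (u, 0)
      rw [ambient_apply] at this
      simp [h2] at this ⊢
      linear_combination this
    · have := key (0, 1)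
      rw [ambient_apply] at this
      simp [h2] at this
      linear_combination this
  refine ⟨hsym, hn, hl, fun θ => (key θ).1, fun θ => (key θ).2, fun v hg hv => ?_⟩
  have : ((v, 0) : TangentSpace (𝓡 n) p × ℝ) = 0 := by
    apply (D.ambientEquiv p).injective
    ext y <;> simp [ambient_apply, hg, hv]
  simpa using congrArg Prod.fst this

end NullMetricHypersurfaceData

/-! ### Smoothness of the derived fields -/

namespace NullMetricHypersurfaceData

variable {n : ℕ} {N : Type*} [TopologicalSpace N] [ChartedSpace (EuclideanSpace ℝ (Fin n)) N]
  [IsManifold (𝓡 n) ∞ N]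

lemma smoothTen_of_contMDiff
    {g : (p : N) → TangentSpace (𝓡 n) p →L[ℝ] TangentSpace (𝓡 n) p →L[ℝ] ℝ}
    (hg : ContMDiff (𝓡 n)
      ((𝓡 n).prod 𝓘(ℝ, EuclideanSpace ℝ (Fin n) →L[ℝ] EuclideanSpace ℝ (Fin n) →L[ℝ] ℝ)) ∞
      (fun p => Bundle.TotalSpace.mk'
        (EuclideanSpace ℝ (Fin n) →L[ℝ] EuclideanSpace ℝ (Fin n) →L[ℝ] ℝ)
        (E := fun p : N => TangentSpace (𝓡 n) p →L[ℝ] TangentSpace (𝓡 n) p →L[ℝ] ℝ) p (g p)))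
    (p : N) : SmoothTen (n := n) (fun q => (g q).toLinearMap₁₂) p := by
  intro X Z hX hZ
  filter_upwards [hX, hZ] with q hX hZ
  have : ContMDiffAt (𝓡 n) ((𝓡 n).prod 𝓘(ℝ)) ∞
      (fun m => Bundle.TotalSpace.mk' ℝ (E := Bundle.Trivial N ℝ) m (g m (X m) (Z m))) q :=
    ContMDiffAt.clm_bundle_apply₂ (F₁ := EuclideanSpace ℝ (Fin n))
      (F₂ := EuclideanSpace ℝ (Fin n)) (hg q) hX hZ
  simp only [Bundle.contMDiffAt_totalSpace] at this
  exact this.2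

lemma smoothCov_of_contMDiff {l : (p : N) → TangentSpace (𝓡 n) p →L[ℝ] ℝ}
    (hl : ContMDiff (𝓡 n) ((𝓡 n).prod 𝓘(ℝ, EuclideanSpace ℝ (Fin n) →L[ℝ] ℝ)) ∞
      (fun p => Bundle.TotalSpace.mk' (EuclideanSpace ℝ (Fin n) →L[ℝ] ℝ)
        (E := fun p : N => TangentSpace (𝓡 n) p →L[ℝ] ℝ) p (l p)))
    (p : N) : SmoothCov (n := n) (fun q => (l q).toLinearMap) p := by
  intro X hX
  filter_upwards [hX] with q hX
  have : ContMDiffAt (𝓡 n) ((𝓡 n).prod 𝓘(ℝ)) ∞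
      (fun m => Bundle.TotalSpace.mk' ℝ (E := Bundle.Trivial N ℝ) m (l m (X m))) q :=
    ContMDiffAt.clm_bundle_apply (F₁ := EuclideanSpace ℝ (Fin n)) (hl q) hX
  simp only [Bundle.contMDiffAt_totalSpace] at this
  exact this.2

variable (D : NullMetricHypersurfaceData n N) (p : N)

lemma smooth_γ : SmoothTen D.γ p := smoothTen_of_contMDiff D.metric_smooth p

lemma smooth_ℓ : SmoothCov D.ℓ p := smoothCov_of_contMDiff D.covec_smooth p

lemma smooth_ell2 : SmoothFn (n := n) D.ell2 p := .of_forall D.ell2_smooth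

variable {p}

/-- The solution of a linear system with matrix `𝒜` and smooth right-hand side is smooth, by
Cramer's rule in a local frame. -/
lemma smoothNear_of_ambient {V : VField n N} {b : N → ℝ} {θ : CovField n N} {f : N → ℝ}
    (hV : ∀ q y, D.ambientEquiv q (V q, b q) y = θ q y.1 + f q * y.2)
    (hθ : SmoothCov θ p) (hf : SmoothFn (n := n) f p) : SmoothNear V p := by
  let e := localFrameAt (n := n) p
  let E : (q : N) → Option (Fin n) → TangentSpace (𝓡 n) q × ℝ :=
    fun q i => i.elim (0, 1) fun i => (e.vec i q, 0)
  let M : N → Matrix (Option (Fin n)) (Option (Fin n)) ℝ :=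
    fun q => .of fun i j => D.ambientEquiv q (E q j) (E q i)
  let rhs : N → Option (Fin n) → ℝ := fun q i => θ q (E q i).1 + f q * (E q i).2
  have hM : ∀ i j, SmoothFn (n := n) (fun q => M q i j) p := by
    rintro (_ | i) (_ | j)
    · simpa [M, E, ambient_apply] using D.smooth_ell2 p
    · simpa [M, E, ambient_apply] using D.smooth_ℓ p _ (e.smooth_vec j)
    · simpa [M, E, ambient_apply] using D.smooth_ℓ p _ (e.smooth_vec i)
    · simpa [M, E, ambient_apply] using D.smooth_γ p _ _ (e.smooth_vec j) (e.smooth_vec i)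
  have hrhs : ∀ i, SmoothFn (n := n) (fun q => rhs q i) p := by
    rintro (_ | i)
    · simpa [rhs, E] using hf
    · simpa [rhs, E] using hθ _ (e.smooth_vec i)
  have hmul : ∀ q (x : Option (Fin n) → ℝ),
      (M q).mulVec x = fun i => D.ambientEquiv q (∑ j, x j • E q j) (E q i) := by
    intro q x
    ext i
    simp [Matrix.mulVec, dotProduct, M, mul_comm]
  have hext : ∀ q, (∀ v : TangentSpace (𝓡 n) q, ∑ i, e.coeff i q v • e.vec i q = v) →
      ∀ φ ψ : Dual ℝ (TangentSpace (𝓡 n) q × ℝ), (∀ i, φ (E q i) = ψ (E q i)) → φ = ψ := by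
    intro q hq φ ψ h
    refine LinearMap.ext fun y => ?_
    have hy : y = (∑ i, e.coeff i q y.1 • E q (some i)) + y.2 • E q none := by
      ext
      · simp [E, hq y.1, Prod.fst_sum]
      · simp [E, Prod.snd_sum]
    rw [hy, map_add, map_sum, map_add, map_sum]
    simp only [map_smul, h]
  have hdet : ∀ᶠ q in 𝓝 p, (M q).det ≠ 0 := by
    filter_upwards [e.sum_eq, e.coeff_vec] with q hq hq' h0
    obtain ⟨x, hx, h⟩ := Matrix.exists_mulVec_eq_zero_iff.2 h0
    have h1 : ∑ j, x j • E q j = 0 := by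
      apply (D.ambientEquiv q).injective
      rw [hmul] at h
      have h' : ∀ i, D.ambientEquiv q (∑ j, x j • E q j) (E q i) = 0 := fun i => congrFun h i
      rw [map_zero]
      exact hext q hq _ _ h'
    apply hx
    have h2 := congrArg Prod.snd h1
    have h3 := congrArg Prod.fst h1
    simp only [Fintype.sum_option, E, Option.elim, Prod.smul_mk, smul_zero, Prod.snd_add,
      Prod.fst_add, Prod.fst_sum, Prod.snd_sum, Prod.fst_zero, Prod.snd_zero, zero_add,
      smul_eq_mul, mul_one, mul_zero, Finset.sum_const_zero, add_zero] at h2 h3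
    ext (_ | i)
    · exact h2
    · have := congrArg (e.coeff i q) h3
      simpa [hq'] using this
  let x : Option (Fin n) → N → ℝ := fun i q => (M q).cramer (rhs q) i / (M q).det
  refine SmoothNear.of_coeff e (f := fun i => x (some i)) (fun i => ?_) ?_
  · refine SmoothFn.div ?_ (SmoothFn.det hM) hdet
    simp only [Matrix.cramer_apply]
    refine SmoothFn.det fun j k => ?_
    by_cases hk : k = some i
    · simpa [Matrix.updateCol_apply, hk] using hrhs j
    · simpa [Matrix.updateCol_apply, hk] using hM j k
  · filter_upwards [hdet, e.sum_eq] with q hdet hq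
    have h1 : (M q).mulVec (fun i => x i q) = rhs q := by
      have := Matrix.mulVec_cramer (M q) (rhs q)
      have hx : (fun i => x i q) = (M q).det⁻¹ • (M q).cramer (rhs q) := by
        ext i
        simp [x, div_eq_inv_mul]
      rw [hx, Matrix.mulVec_smul, this, smul_smul, inv_mul_cancel₀ hdet, one_smul]
    have h2 : (V q, b q) = ∑ j, x j q • E q j := by
      apply (D.ambientEquiv q).injective
      rw [hmul] at h1
      have h' : ∀ i, D.ambientEquiv q (∑ j, x j q • E q j) (E q i)
          = D.ambientEquiv q (V q, b q) (E q i) := fun i => by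
        rw [hV]; exact congrFun h1 i
      exact (hext q hq _ _ h').symm
    have h3 := congrArg Prod.fst h2
    simpa [Fintype.sum_option, E, Prod.fst_sum] using h3

variable (p)

lemma smooth_nvec : SmoothNear D.nvec p := by
  refine D.smoothNear_of_ambient (b := fun _ => 0) (θ := 0) (f := fun _ => 1) (fun q y => ?_)
    (fun X _ => by simpa using SmoothFn.const 0) (SmoothFn.const 1)
  have h := D.isNullFrame q
  simp [ambient_apply, h.g_n, h.l_n]

variable {p}

lemma smooth_P {θ : CovField n N} (hθ : SmoothCov θ p) : SmoothNear (fun q => D.P q (θ q)) p := by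
  refine D.smoothNear_of_ambient (b := fun q => θ q (D.nvec q)) (f := fun _ => 0) (fun q y => ?_)
    hθ (SmoothFn.const 0)
  have h := D.isNullFrame q
  simp [ambient_apply, h.g_P, h.l_P]
  ring

lemma smooth_trP {T : Tensor02Field n N} (hT : SmoothTen T p) :
    SmoothFn (n := n) (D.trP T) p := by
  let e := localFrameAt (n := n) p
  refine (SmoothFn.sum (s := Finset.univ) fun i _ => e.smooth_coeff i _
    (D.smooth_P (hT.apply (e.smooth_vec i)))).congr ?_
  filter_upwards [e.sum_eq] with q hq
  have := finiteDimensional_tangentSpace (n := n) q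
  exact trace_eq_sum (e := fun i => e.vec i q) (c := fun i => e.coeff i q) hq _

variable (p)

lemma smooth_F : SmoothTen D.F p :=
  .smul (SmoothFn.const _) (SmoothCov.extDeriv D.smooth_ℓ)

lemma smooth_s : SmoothCov D.s p := (D.smooth_F p).apply (D.smooth_nvec p)

lemma smooth_C : SmoothTen D.C p :=
  .add ((D.smooth_ℓ p).tensorProd (D.smooth_ℓ p))
    (.smul ((D.smooth_ell2 p).div_const _) (D.smooth_γ p))

end NullMetricHypersurfaceData

/-! ### Existence of the metric hypersurface connection -/

section Connection

variable {n : ℕ} {N : Type*} [TopologicalSpace N] [ChartedSpace (EuclideanSpace ℝ (Fin n)) N]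
  [IsManifold (𝓡 n) ∞ N] {p : N}

/-- A linear connection on the tangent bundle. -/
abbrev TangentConnection (n : ℕ) (N : Type*) [TopologicalSpace N]
    [ChartedSpace (EuclideanSpace ℝ (Fin n)) N] [IsManifold (𝓡 n) ∞ N] :=
  CovariantDerivative (𝓡 n) (EuclideanSpace ℝ (Fin n)) (TangentSpace (𝓡 n) : N → Type _)

/-- The connection which at each point `p` agrees with the flat connection of the frame
`localFrameAt p`. As `p` varies it need not be smooth; a `CovariantDerivative` only has to satisfy
the Leibniz rule pointwise. -/
def frameConnection : TangentConnection n N where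
  toFun Z p := ∑ i, (mvfderiv (𝓡 n) (fun q => (localFrameAt p).coeff i q (Z q)) p).smulRight
    ((localFrameAt p).vec i p)
  isCovariantDerivativeOnUniv :=
    { add := fun {Z W p} hZ hW _ => by
        let e := localFrameAt (n := n) p
        ext v : 1
        have h := fun i => dd_add (e.diff_coeff i Z hZ) (e.diff_coeff i W hW) v
        simp only [dd, ContinuousLinearMap.coe_coe] at h
        simp only [add_apply, sum_apply,
          ContinuousLinearMap.smulRight_apply, Pi.add_apply, map_add, ← Finset.sum_add_distrib,
          ← add_smul]
        exact Finset.sum_congr rfl fun i _ => congrArg (· • e.vec i p) (h i)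
      leibniz := fun {Z f p} hZ hf _ => by
        let e := localFrameAt (n := n) p
        ext v : 1
        have h := fun i => dd_mul hf (e.diff_coeff i Z hZ) v
        simp only [dd, ContinuousLinearMap.coe_coe] at h
        simp only [add_apply, sum_apply,
          ContinuousLinearMap.smulRight_apply, Pi.smul_apply', map_smul, smul_eq_mul,
          smul_apply]
        conv_rhs => rw [← (e.sum_eq.self_of_nhds) (Z p)]
        rw [Finset.smul_sum, Finset.smul_sum, ← Finset.sum_add_distrib]
        refine Finset.sum_congr rfl fun i _ => ?_
        refine (congrArg (· • e.vec i p) (h i)).trans ?_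
        simp only [add_smul, smul_smul]
        rw [add_comm] }

/-- Torsion is removed from any connection by adding half of it as a one-form. -/
lemma exists_torsion_eq_zero : ∃ cov : TangentConnection n N, cov.torsion = 0 := by
  refine ⟨frameConnection.addOneForm fun x => (1 / 2 : ℝ) • frameConnection.torsion x, ?_⟩
  rw [CovariantDerivative.torsion_eq_zero_iff]
  intro X Y x hX hY
  have h := frameConnection.torsion_apply hX hY
  have h' := frameConnection.torsion_antisymm (Y x) (X x)
  have e : ∀ Z : VField n N, (frameConnection.addOneForm fun x =>
      (1 / 2 : ℝ) • frameConnection.torsion x) Z x = frameConnection Z x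
        + (1 / 2 : ℝ) • frameConnection.torsion x (Z x) := fun Z => rfl
  simp only [e, add_apply, smul_apply, h', h]
  module

lemma torsion_free {cov : TangentConnection n N} (h : cov.torsion = 0) {X Z : VField n N}
    (hX : SmoothNear X p) (hZ : SmoothNear Z p) :
    bracket X Z p = cov.toFun Z p (X p) - cov.toFun X p (Z p) :=
  ((cov.torsion_eq_zero_iff.1 h) hX.diff hZ.diff).symm

/-- The covariant derivative `∇_x T` of a `(0,2)`-tensor field along a tangent vector `x`. -/
def nablaTen (cov : TangentConnection n N) (T : Tensor02Field n N) (p : N)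
    (x : TangentSpace (𝓡 n) p) : LinearMap.BilinForm ℝ (TangentSpace (𝓡 n) p) :=
  tensorAt p fun Z W => dd (fun q => T q (Z q) (W q)) p x
    - T p (cov.toFun Z p x) (W p) - T p (Z p) (cov.toFun W p x)

variable (cov : TangentConnection n N) {T : Tensor02Field n N} {X Z W : VField n N}

lemma nablaTen_apply (hT : SmoothTen T p) (x : TangentSpace (𝓡 n) p)
    (hZ : SmoothNear Z p) (hW : SmoothNear W p) :
    nablaTen cov T p x (Z p) (W p) = dd (fun q => T q (Z q) (W q)) p x
      - T p (cov.toFun Z p x) (W p) - T p (Z p) (cov.toFun W p x) := by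
  refine tensorAt_apply (Φ := fun Z W => dd (fun q => T q (Z q) (W q)) p x
      - T p (cov.toFun Z p x) (W p) - T p (Z p) (cov.toFun W p x))
    (fun W hW => ⟨fun {f Z} hf hZ => ?_, fun {Z Z'} hZ hZ' => ?_⟩)
    (fun Z hZ => ⟨fun {f W} hf hW => ?_, fun {W W'} hW hW' => ?_⟩) hZ hW
  · have h1 := dd_mul hf (hT.diff hZ hW) x
    have h2 : cov.toFun (f • Z) p x = _ := cov_smul cov x hf hZ
    simp only [Pi.smul_apply', map_smul, smul_eq_mul, h2, h1, LinearMap.smul_apply, map_add,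
      LinearMap.add_apply]
    ring
  · have h1 := dd_add (hT.diff hZ hW) (hT.diff hZ' hW) x
    have h2 : cov.toFun (Z + Z') p x = _ := cov_add cov x hZ hZ'
    simp only [Pi.add_apply, map_add, h2, h1, LinearMap.add_apply]
    ring
  · have h1 := dd_mul hf (hT.diff hZ hW) x
    have h2 : cov.toFun (f • W) p x = _ := cov_smul cov x hf hW
    simp only [Pi.smul_apply', map_smul, smul_eq_mul, h2, h1, map_add]
    ring
  · have h1 := dd_add (hT.diff hZ hW) (hT.diff hZ hW') x
    have h2 : cov.toFun (W + W') p x = _ := cov_add cov x hW hW'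
    simp only [Pi.add_apply, map_add, h2, h1]
    ring

lemma nablaTen_add (hT : SmoothTen T p) (x y : TangentSpace (𝓡 n) p) :
    nablaTen cov T p (x + y) = nablaTen cov T p x + nablaTen cov T p y := by
  refine ten_ext fun Z W hZ hW => ?_
  simp only [LinearMap.add_apply, nablaTen_apply cov hT _ hZ hW, map_add]
  ring

lemma nablaTen_smul (hT : SmoothTen T p) (a : ℝ) (x : TangentSpace (𝓡 n) p) :
    nablaTen cov T p (a • x) = a • nablaTen cov T p x := by
  refine ten_ext fun Z W hZ hW => ?_
  simp only [LinearMap.smul_apply, nablaTen_apply cov hT _ hZ hW, map_smul, smul_eq_mul]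
  ring

lemma nablaTen_symm (hT : SmoothTen T p) (hsym : ∀ q u v, T q u v = T q v u)
    (x u v : TangentSpace (𝓡 n) p) : nablaTen cov T p x u v = nablaTen cov T p x v u := by
  have h : nablaTen cov T p x = LinearMap.flip (nablaTen cov T p x) := by
    refine ten_ext fun Z W hZ hW => ?_
    have h1 : (fun q => T q (Z q) (W q)) = fun q => T q (W q) (Z q) := by
      ext q; exact hsym _ _ _
    rw [LinearMap.flip_apply, nablaTen_apply cov hT _ hZ hW, nablaTen_apply cov hT _ hW hZ, h1,
      hsym p (cov.toFun Z p x), hsym p (Z p)]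
    ring
  exact congrArg (fun B => B u v) h

end Connection

namespace NullMetricHypersurfaceData

variable {n : ℕ} {N : Type*} [TopologicalSpace N] [ChartedSpace (EuclideanSpace ℝ (Fin n)) N]
  [IsManifold (𝓡 n) ∞ N] (D : NullMetricHypersurfaceData n N) {p : N} {X Z : VField n N}

lemma U_apply (hX : SmoothNear X p) (hZ : SmoothNear Z p) :
    D.U p (X p) (Z p) = 1 / 2 * (dd (fun q => D.γ q (X q) (Z q)) p (D.nvec p)
      - D.γ p (bracket D.nvec X p) (Z p) - D.γ p (X p) (bracket D.nvec Z p)) := by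
  rw [← lieTensor_apply (D.smooth_γ p) hX hZ]
  rfl

lemma γ_nvec (p : N) : D.γ p (D.nvec p) = 0 := (D.isNullFrame p).g_n

lemma γ_nvec_right (u : TangentSpace (𝓡 n) p) : D.γ p u (D.nvec p) = 0 :=
  (D.isNullFrame p).g_n_right u

lemma γ_symm (u v : TangentSpace (𝓡 n) p) : D.γ p u v = D.γ p v u :=
  (D.isNullFrame p).g_symm u v

lemma ℓ_nvec (p : N) : D.ℓ p (D.nvec p) = 1 := (D.isNullFrame p).l_n

lemma lieTensor_symm {T : Tensor02Field n N} (hT : SmoothTen T p)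
    (hsym : ∀ q u v, T q u v = T q v u) (u v : TangentSpace (𝓡 n) p) :
    lieTensor X T p u v = lieTensor X T p v u := by
  have h : lieTensor X T p = LinearMap.flip (lieTensor X T p) := by
    refine ten_ext fun Z W hZ hW => ?_
    have h1 : (fun q => T q (Z q) (W q)) = fun q => T q (W q) (Z q) := by
      ext q; exact hsym _ _ _
    rw [LinearMap.flip_apply, lieTensor_apply hT hZ hW, lieTensor_apply hT hW hZ, h1,
      hsym p (bracket X Z p), hsym p (Z p)]
    ring
  exact congrArg (fun B => B u v) h

lemma U_symm (u v : TangentSpace (𝓡 n) p) : D.U p u v = D.U p v u :=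
  congrArg ((1 / 2 : ℝ) * ·) (lieTensor_symm (D.smooth_γ p) (fun _ => D.γ_symm) u v)

/-- The Lie derivative along `n` of a tensor annihilated by `n` is annihilated by `n`. -/
lemma lieTensor_nvec {T : Tensor02Field n N} (hT : SmoothTen T p)
    (hn : ∀ q, T q (D.nvec q) = 0) : lieTensor D.nvec T p (D.nvec p) = 0 := by
  refine cov_ext fun Z hZ => ?_
  rw [lieTensor_apply hT (D.smooth_nvec p) hZ, bracket_self]
  simp [hn, dd_const]

lemma U_nvec (p : N) : D.U p (D.nvec p) = 0 := by
  have h := D.lieTensor_nvec (D.smooth_γ p) D.γ_nvec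
  simp [U, h]

lemma U_nvec_right (u : TangentSpace (𝓡 n) p) : D.U p u (D.nvec p) = 0 := by
  rw [D.U_symm, D.U_nvec]; rfl

/-- Existence of the metric hypersurface connection. Starting from a torsion-free `∇`, the required
connection is `∇ + S` with `S` symmetric, and the two conditions prescribe `γ(S(x,z),·)`, by the
Koszul trick, and `ℓ(S(x,z))`. These are solvable since the Koszul expression vanishes on `n`, which
is the identity `2U = £_n γ` written with `∇`. -/
lemma exists_metricHypersurfaceConnection : ∃ cov, D.IsMetricHypersurfaceConnection cov := by
  obtain ⟨cov, hcov⟩ := exists_torsion_eq_zero (n := n) (N := N)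
  -- `A x z w` is `(∇_x γ)(z, w)`.
  let A : (p : N) → (x : TangentSpace (𝓡 n) p) →
    LinearMap.BilinForm ℝ (TangentSpace (𝓡 n) p) := fun p x => nablaTen cov D.γ p x
  have hadd : ∀ p (x y : TangentSpace (𝓡 n) p), A p (x + y) = A p x + A p y :=
    fun p => nablaTen_add cov (D.smooth_γ p)
  have hsmul : ∀ p (a : ℝ) (x : TangentSpace (𝓡 n) p), A p (a • x) = a • A p x :=
    fun p => nablaTen_smul cov (D.smooth_γ p)
  have hsym : ∀ p (x u v : TangentSpace (𝓡 n) p), A p x u v = A p x v u :=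
    fun p => nablaTen_symm cov (D.smooth_γ p) fun _ => D.γ_symm
  -- The Koszul expression for `γ(S(x,z), w)`, where `S` is the difference of the connections.
  let K : (p : N) → TangentSpace (𝓡 n) p →ₗ[ℝ] TangentSpace (𝓡 n) p →ₗ[ℝ]
      Dual ℝ (TangentSpace (𝓡 n) p) := fun p =>
    LinearMap.mk₂ ℝ (fun x z =>
      { toFun := fun w => 1 / 2 * (A p x z w + A p z x w - A p w x z) + D.U p x z * D.ℓ p w
        map_add' := fun w w' => by simp [hadd]; ring
        map_smul' := fun a w => by simp [hsmul]; ring })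
      (fun x x' z => by ext w; simp [hadd]; ring) (fun a x z => by ext w; simp [hsmul]; ring)
      (fun x z z' => by ext w; simp [hadd]; ring) (fun a x z => by ext w; simp [hsmul]; ring)
  have hK : ∀ p (x z w : TangentSpace (𝓡 n) p), K p x z w =
    1 / 2 * (A p x z w + A p z x w - A p w x z) + D.U p x z * D.ℓ p w := fun _ _ _ _ => rfl
  have hKn : ∀ p (x z : TangentSpace (𝓡 n) p), K p x z (D.nvec p) = 0 := by
    intro p x z
    have hx := smoothNear_ext (n := n) x
    have hz := smoothNear_ext (n := n) z
    have hn := D.smooth_nvec p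
    have key : ∀ (y : TangentSpace (𝓡 n) p) (u : TangentSpace (𝓡 n) p),
        A p y u (D.nvec p) = - D.γ p u (cov.toFun D.nvec p y) := by
      intro y u
      have := nablaTen_apply cov (D.smooth_γ p) y (smoothNear_ext u) hn
      simp only [γ_nvec_right, dd_const, ext_self] at this
      exact this.trans (by ring)
    have h1 := nablaTen_apply cov (D.smooth_γ p) (D.nvec p) hx hz
    have h2 := D.U_apply hx hz
    -- Torsion-freeness turns the brackets in `£_n γ` into covariant derivatives.
    rw [torsion_free hcov hn hx, torsion_free hcov hn hz] at h2
    simp only [ext_self, map_sub, LinearMap.sub_apply] at h1 h2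
    rw [hK, key, key, ℓ_nvec, h2]
    have h1 : A p (D.nvec p) x z = _ := h1
    rw [h1, D.γ_symm (cov.toFun D.nvec p x) z]
    ring
  let H : (p : N) → LinearMap.BilinForm ℝ (TangentSpace (𝓡 n) p) := fun p =>
    symPart (nablaCov cov.toFun D.ℓ p) + D.ell2 p • D.U p
  let S : (p : N) → TangentSpace (𝓡 n) p →ₗ[ℝ] TangentSpace (𝓡 n) p →ₗ[ℝ]
      TangentSpace (𝓡 n) p := fun p =>
    LinearMap.mk₂ ℝ (fun x z => D.P p (K p x z) + H p x z • D.nvec p)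
      (fun x x' z => by simp only [map_add, LinearMap.add_apply]; module)
      (fun a x z => by simp only [map_smul, LinearMap.smul_apply, smul_eq_mul]; module)
      (fun x x' z => by simp only [map_add]; module)
      (fun a x z => by simp only [map_smul, smul_eq_mul]; module)
  have hSγ : ∀ p (x z w : TangentSpace (𝓡 n) p), D.γ p (S p x z) w = K p x z w := by
    intro p x z w
    change D.γ p (D.P p (K p x z) + H p x z • D.nvec p) w = _
    simp [(D.isNullFrame p).g_P, hKn, γ_nvec]
  have hSℓ : ∀ p (x z : TangentSpace (𝓡 n) p), D.ℓ p (S p x z) = H p x z := by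
    intro p x z
    change D.ℓ p (D.P p (K p x z) + H p x z • D.nvec p) = _
    simp [(D.isNullFrame p).l_P, hKn, ℓ_nvec]
  have hSsym : ∀ p (x z : TangentSpace (𝓡 n) p), S p x z = S p z x := by
    intro p x z
    have h1 : K p x z = K p z x := by
      ext w
      rw [hK, hK, hsym p w x z, D.U_symm x z]
      ring
    have h2 : H p x z = H p z x := by
      simp only [H, LinearMap.add_apply, symPart_apply, LinearMap.smul_apply, D.U_symm x z]
      ring
    change D.P p (K p x z) + H p x z • D.nvec p = D.P p (K p z x) + H p z x • D.nvec p
    rw [h1, h2]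
  have hfin := finiteDimensional_tangentSpace (n := n) (N := N)
  have hT2 : ∀ q : N, T2Space (TangentSpace (𝓡 n) q) := fun q =>
    inferInstanceAs (T2Space (EuclideanSpace ℝ (Fin n)))
  let cov' : TangentConnection n N := cov.addOneForm fun p => (S p).toContinuousBilinearMap
  have hcov' : ∀ (X : VField n N) p v, cov'.toFun X p v = cov.toFun X p v + S p (X p) v :=
    fun X p v => rfl
  refine ⟨cov', ?_, ?_, ?_⟩
  · rw [CovariantDerivative.torsion_eq_zero_iff]
    intro X Z q hX hZ
    have h := cov.torsion_eq_zero_iff.1 hcov hX hZ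
    change cov'.toFun Z q (X q) - cov'.toFun X q (Z q) = _
    rw [hcov', hcov', hSsym q (Z q), ← h]
    exact add_sub_add_right_eq_sub _ _ _
  · intro p X Z W hX hZ hW
    have h : A p (X p) (Z p) (W p) = _ := nablaTen_apply cov (D.smooth_γ p) (X p) hZ hW
    simp only [covDeriv, hcov', map_add, LinearMap.add_apply, hSγ, D.γ_symm (Z p) (S p _ _), hK]
    rw [hsym p (Z p) (X p) (W p), hsym p (X p) (W p) (Z p), hsym p (W p) (X p) (Z p),
      D.U_symm (Z p) (X p), D.U_symm (W p) (X p)]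
    linear_combination -h
  · intro p X Z hX hZ
    have h1 := nablaCov_apply cov (D.smooth_ℓ p) hX hZ
    have h2 := nablaCov_apply cov (D.smooth_ℓ p) hZ hX
    simp only [covDeriv, hcov', map_add, hSℓ, hSsym p (Z p) (X p)]
    simp only [H, LinearMap.add_apply, symPart_apply, LinearMap.smul_apply, smul_eq_mul]
    linear_combination -h1 - h2

/-- The metric hypersurface connection exists, so `D.conn` has its defining properties. -/
lemma exists_conn_eq : ∃ cov : TangentConnection n N,
    D.IsMetricHypersurfaceConnection cov ∧ D.conn = cov.toFun := by
  have h := D.exists_metricHypersurfaceConnection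
  exact ⟨h.choose, h.choose_spec, by rw [conn, dif_pos h]⟩

end NullMetricHypersurfaceData

/-! ### Leibniz rules -/

section Leibniz

variable {n : ℕ} {N : Type*} [TopologicalSpace N] [ChartedSpace (EuclideanSpace ℝ (Fin n)) N]
  [IsManifold (𝓡 n) ∞ N] {p : N} {X : VField n N} {θ η : CovField n N} {S T : Tensor02Field n N}
  {f : N → ℝ}

lemma lieTensor_add (hS : SmoothTen S p) (hT : SmoothTen T p) :
    lieTensor X (fun q => S q + T q) p = lieTensor X S p + lieTensor X T p := by
  refine ten_ext fun Z W hZ hW => ?_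
  simp only [LinearMap.add_apply, lieTensor_apply (hS.add hT) hZ hW, lieTensor_apply hS hZ hW,
    lieTensor_apply hT hZ hW, dd_add (hS Z W hZ hW).diff (hT Z W hZ hW).diff]
  ring

lemma lieTensor_smul (hf : SmoothFn (n := n) f p) (hT : SmoothTen T p) :
    lieTensor X (fun q => f q • T q) p = dd f p (X p) • T p + f p • lieTensor X T p := by
  refine ten_ext fun Z W hZ hW => ?_
  simp only [LinearMap.add_apply, LinearMap.smul_apply, smul_eq_mul,
    lieTensor_apply (SmoothTen.smul hf hT) hZ hW, lieTensor_apply hT hZ hW,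
    dd_mul hf.diff (hT Z W hZ hW).diff]
  ring

lemma lieTensor_const_smul (c : ℝ) (hT : SmoothTen T p) :
    lieTensor X (fun q => c • T q) p = c • lieTensor X T p := by
  rw [lieTensor_smul (SmoothFn.const c) hT, dd_const]
  simp

lemma lieTensor_sub (hS : SmoothTen S p) (hT : SmoothTen T p) :
    lieTensor X (fun q => S q - T q) p = lieTensor X S p - lieTensor X T p := by
  refine ten_ext fun Z W hZ hW => ?_
  simp only [LinearMap.sub_apply, lieTensor_apply (hS.sub hT) hZ hW, lieTensor_apply hS hZ hW,
    lieTensor_apply hT hZ hW, dd_sub (hS Z W hZ hW).diff (hT Z W hZ hW).diff]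
  ring

lemma lieTensor_symProd (hθ : SmoothCov θ p) (hη : SmoothCov η p) :
    lieTensor X (fun q => symProd (θ q) (η q)) p
      = symProd (lieCov X θ p) (η p) + symProd (θ p) (lieCov X η p) := by
  refine ten_ext fun Z W hZ hW => ?_
  have h1 : ∀ v : TangentSpace (𝓡 n) p, dd (fun q => symProd (θ q) (η q) (Z q) (W q)) p v = 1 / 2 *
      (dd (fun q => θ q (Z q)) p v * η p (W p) + θ p (Z p) * dd (fun q => η q (W q)) p v
      + (dd (fun q => θ q (W q)) p v * η p (Z p) + θ p (W p) * dd (fun q => η q (Z q)) p v)) := by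
    intro v
    have e1 := (hθ Z hZ).mul (hη W hW)
    have e2 := (hθ W hW).mul (hη Z hZ)
    refine (dd_mul (SmoothFn.const (n := n) (1 / 2)).diff (e1.add e2).diff v).trans ?_
    rw [dd_const, dd_add e1.diff e2.diff, dd_mul (hθ Z hZ).diff (hη W hW).diff,
      dd_mul (hθ W hW).diff (hη Z hZ).diff]
    ring
  rw [lieTensor_apply (hθ.symProd hη) hZ hW, h1]
  simp only [LinearMap.add_apply, symProd_apply, lieCov_apply hθ hZ, lieCov_apply hη hZ,
    lieCov_apply hθ hW, lieCov_apply hη hW]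
  ring

variable (cov : TangentConnection n N)

lemma nablaCov_add (hθ : SmoothCov θ p) (hη : SmoothCov η p) :
    nablaCov cov.toFun (fun q => θ q + η q) p
      = nablaCov cov.toFun θ p + nablaCov cov.toFun η p := by
  refine ten_ext fun Z W hZ hW => ?_
  simp only [LinearMap.add_apply, nablaCov_apply cov (hθ.add hη) hZ hW,
    nablaCov_apply cov hθ hZ hW, nablaCov_apply cov hη hZ hW, dd_add (hθ W hW).diff (hη W hW).diff]
  ring

lemma nablaCov_sub (hθ : SmoothCov θ p) (hη : SmoothCov η p) :
    nablaCov cov.toFun (fun q => θ q - η q) p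
      = nablaCov cov.toFun θ p - nablaCov cov.toFun η p := by
  refine ten_ext fun Z W hZ hW => ?_
  simp only [LinearMap.sub_apply, nablaCov_apply cov (hθ.sub hη) hZ hW,
    nablaCov_apply cov hθ hZ hW, nablaCov_apply cov hη hZ hW, dd_sub (hθ W hW).diff (hη W hW).diff]
  ring

lemma nablaCov_smul (hf : SmoothFn (n := n) f p) (hθ : SmoothCov θ p) :
    nablaCov cov.toFun (fun q => f q • θ q) p
      = tensorProd (dd f p) (θ p) + f p • nablaCov cov.toFun θ p := by
  refine ten_ext fun Z W hZ hW => ?_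
  simp only [LinearMap.add_apply, LinearMap.smul_apply, smul_eq_mul, tensorProd_apply,
    nablaCov_apply cov (SmoothCov.smul hf hθ) hZ hW, nablaCov_apply cov hθ hZ hW,
    dd_mul hf.diff (hθ W hW).diff]
  ring

lemma lieCov_self_of_annihilates (hX : SmoothNear X p) (hθ : SmoothCov θ p)
    (h0 : ∀ q, θ q (X q) = 0) : lieCov X θ p (X p) = 0 := by
  rw [lieCov_apply hθ hX, bracket_self]
  simp [h0, dd_const]

end Leibniz

namespace NullMetricHypersurfaceData

variable {n : ℕ} {N : Type*} [TopologicalSpace N] [ChartedSpace (EuclideanSpace ℝ (Fin n)) N]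
  [IsManifold (𝓡 n) ∞ N] (D : NullMetricHypersurfaceData n N) {p : N}
  {θ : CovField n N} {T : Tensor02Field n N} {X Z : VField n N}

lemma F_apply (hX : SmoothNear X p) (hZ : SmoothNear Z p) :
    D.F p (X p) (Z p) = 1 / 2 * (dd (fun q => D.ℓ q (Z q)) p (X p)
      - dd (fun q => D.ℓ q (X q)) p (Z p) - D.ℓ p (bracket X Z p)) := by
  rw [← extDerivCov_apply (D.smooth_ℓ p) hX hZ]
  rfl

lemma lieCov_ℓ : lieCov D.nvec D.ℓ p = (2 : ℝ) • D.s p := by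
  refine cov_ext fun Z hZ => ?_
  have h := D.F_apply (D.smooth_nvec p) hZ
  simp only [ℓ_nvec, dd_const] at h
  rw [lieCov_apply (D.smooth_ℓ p) hZ]
  change _ = 2 * D.F p (D.nvec p) (Z p)
  linear_combination -2 * h

lemma lieTensor_γ : lieTensor D.nvec D.γ p = (2 : ℝ) • D.U p := by
  simp [U, smul_smul]

lemma s_nvec (p : N) : D.s p (D.nvec p) = 0 := by
  have h := D.F_apply (D.smooth_nvec p) (D.smooth_nvec p)
  rw [bracket_self] at h
  simpa [s] using h

lemma nvec_eq_zero_right (hsym : ∀ u v, T p u v = T p v u) (hn : T p (D.nvec p) = 0)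
    (u : TangentSpace (𝓡 n) p) : T p u (D.nvec p) = 0 := by
  rw [hsym, hn]; rfl

/-! ### The metric hypersurface connection -/

section Connection

variable {cov : TangentConnection n N} (hc : D.IsMetricHypersurfaceConnection cov)

include hc

/-- `∇̊_{(a} ℓ_{b)} = -ℓ⁽²⁾ U_{ab}`. -/
lemma symPart_nabla_ℓ : symPart (nablaCov cov.toFun D.ℓ p) = -(D.ell2 p • D.U p) := by
  refine ten_ext fun X Z hX hZ => ?_
  have h := hc.2.2 p X Z hX hZ
  rw [symPart_apply, nablaCov_apply cov (D.smooth_ℓ p) hX hZ,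
    nablaCov_apply cov (D.smooth_ℓ p) hZ hX]
  simp only [covDeriv] at h
  simp only [LinearMap.neg_apply, LinearMap.smul_apply, smul_eq_mul]
  linear_combination 1 / 2 * h

/-- `ℓ(∇̊_x n) = s(x)`. -/
lemma ℓ_nabla_nvec (x : TangentSpace (𝓡 n) p) : D.ℓ p (cov.toFun D.nvec p x) = D.s p x := by
  have hx := smoothNear_ext (n := n) x
  have hn := D.smooth_nvec p
  have h1 := hc.2.2 p _ _ hx hn
  have h2 := D.F_apply hn hx
  rw [torsion_free hc.1 hn hx] at h2
  simp only [covDeriv, ℓ_nvec, dd_const, ext_self, U_nvec_right, map_sub] at h1 h2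
  change _ = D.F p (D.nvec p) x
  linear_combination -1 / 2 * h1 - h2

lemma γ_nabla_nvec (x u : TangentSpace (𝓡 n) p) :
    D.γ p (cov.toFun D.nvec p x) u = D.U p x u := by
  have hx := smoothNear_ext (n := n) x
  have hu := smoothNear_ext (n := n) u
  have h1 := hc.2.1 p _ _ _ hx (D.smooth_nvec p) hu
  simp only [covDeriv, γ_nvec, LinearMap.zero_apply, dd_const, ext_self, U_nvec_right,
    ℓ_nvec] at h1
  linear_combination -h1

/-- `∇̊_b n^a = P^{ac} U_{bc} + s_b n^a`. -/
lemma nabla_nvec (x : TangentSpace (𝓡 n) p) :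
    cov.toFun D.nvec p x = D.P p (D.U p x) + D.s p x • D.nvec p := by
  have h : D.γ p (cov.toFun D.nvec p x) = D.U p x := LinearMap.ext (D.γ_nabla_nvec hc x)
  rw [(D.isNullFrame p).eq_P_add (cov.toFun D.nvec p x), h, D.ℓ_nabla_nvec hc]

lemma nablaCov_nvec_right (hθ : SmoothCov θ p) (h0 : ∀ q, θ q (D.nvec q) = 0)
    (x : TangentSpace (𝓡 n) p) :
    nablaCov cov.toFun θ p x (D.nvec p) = - D.U p x (D.P p (θ p)) := by
  have h := nablaCov_apply cov hθ (smoothNear_ext x) (D.smooth_nvec p)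
  simp only [h0, dd_const, ext_self, D.nabla_nvec hc, map_add, map_smul, smul_eq_mul] at h
  rw [h, (D.isNullFrame p).P_symm]
  ring

lemma nablaCov_nvec_left (hθ : SmoothCov θ p) (h0 : ∀ q, θ q (D.nvec q) = 0)
    (x : TangentSpace (𝓡 n) p) :
    nablaCov cov.toFun θ p (D.nvec p) x = lieCov D.nvec θ p x - D.U p x (D.P p (θ p)) := by
  have hx := smoothNear_ext (n := n) x
  have h := nablaCov_apply cov hθ (D.smooth_nvec p) hx
  have h2 := lieCov_apply (X := D.nvec) hθ hx
  rw [torsion_free hc.1 (D.smooth_nvec p) hx] at h2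
  simp only [h0, ext_self, D.nabla_nvec hc, map_add, map_sub, map_smul, smul_eq_mul] at h h2
  rw [h, h2, (D.isNullFrame p).P_symm (D.U p x)]
  ring

end Connection

/-! ### Derivative of the trace -/

/-- For `θ` annihilating `n`, `[n, P θ] = P (£_n θ - 2 U(Pθ,·)) - 2 s(Pθ) n`. -/
lemma bracket_P (hθ : SmoothCov θ p) (h0 : ∀ q, θ q (D.nvec q) = 0) :
    bracket D.nvec (fun q => D.P q (θ q)) p
      = D.P p (lieCov D.nvec θ p - (2 : ℝ) • D.U p (D.P p (θ p)))
        - (2 * D.s p (D.P p (θ p))) • D.nvec p := by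
  have hP := D.smooth_P hθ
  have hγ : ∀ q, D.γ q (D.P q (θ q)) = θ q := fun q => by simp [(D.isNullFrame q).g_P, h0]
  have hℓ : ∀ q, D.ℓ q (D.P q (θ q)) = 0 := fun q => by simp [(D.isNullFrame q).l_P, h0]
  have h1 : D.γ p (bracket D.nvec (fun q => D.P q (θ q)) p)
      = lieCov D.nvec θ p - (2 : ℝ) • D.U p (D.P p (θ p)) := by
    refine cov_ext fun Z hZ => ?_
    have h := D.U_apply hP hZ
    simp only [hγ] at h
    simp only [LinearMap.sub_apply, LinearMap.smul_apply, smul_eq_mul, lieCov_apply hθ hZ]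
    linear_combination 2 * h
  have h2 : D.ℓ p (bracket D.nvec (fun q => D.P q (θ q)) p) = -2 * D.s p (D.P p (θ p)) := by
    have h := congrArg (fun α => α (D.P p (θ p))) (D.lieCov_ℓ (p := p))
    have h' := lieCov_apply (X := D.nvec) (D.smooth_ℓ p) hP
    simp only [hℓ, dd_const] at h'
    simp only [LinearMap.smul_apply, smul_eq_mul, h'] at h
    linear_combination -h
  rw [(D.isNullFrame p).eq_P_add (bracket D.nvec _ p), h1, h2]
  module

/-- For symmetric `T` annihilated by `n`, `tr_P (£_n T) = n(tr_P T) + 2 P^{ab} P^{cd} T_{ac} U_{bd}`: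
the last term comes from `£_n P`, through the bracket `[n, P(T(e_i,·))]` for a frame `e_i`. -/
lemma trP_lieTensor (hT : ∀ q, SmoothTen T q) (hsym : ∀ q u v, T q u v = T q v u)
    (hn : ∀ q, T q (D.nvec q) = 0) :
    traceP (D.P p) (lieTensor D.nvec T p) = dd (D.trP T) p (D.nvec p)
      + 2 * traceP (D.P p) (contractP (D.P p) (LinearMap.flip (T p)) (D.U p)) := by
  have hfin := finiteDimensional_tangentSpace (n := n) (N := N)
  let e := localFrameAt (n := n) p
  have hP := fun i => D.smooth_P ((hT p).apply (e.smooth_vec i))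
  have hr : ∀ q u, T q u (D.nvec q) = 0 := fun q => D.nvec_eq_zero_right (hsym q) (hn q)
  let A : TangentSpace (𝓡 n) p →ₗ[ℝ] TangentSpace (𝓡 n) p := D.P p ∘ₗ T p
  have hp := e.sum_eq.self_of_nhds
  have htr : dd (D.trP T) p (D.nvec p)
      = ∑ i, dd (fun q => e.coeff i q (D.P q (T q (e.vec i q)))) p (D.nvec p) := by
    rw [← dd_sum fun i _ => e.smooth_coeff i _ (hP i)]
    refine dd_congr ?_ _
    filter_upwards [e.sum_eq] with q hq
    exact trace_eq_sum (e := fun i => e.vec i q) (c := fun i => e.coeff i q) hq _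
  -- The Lie derivative of the dual coframe is determined by the brackets with the frame.
  have hcoeff : ∀ i (V : VField n N), SmoothNear V p →
      dd (fun q => e.coeff i q (V q)) p (D.nvec p) = e.coeff i p (bracket D.nvec V p)
        - ∑ j, e.coeff j p (V p) * e.coeff i p (bracket D.nvec (e.vec j) p) := by
    intro i V hV
    have hs : SmoothCov (e.coeff i) p := e.smooth_coeff i
    have h := lieCov_apply (X := D.nvec) hs hV
    have h' : ∀ j, lieCov D.nvec (e.coeff i) p (e.vec j p)
        = - e.coeff i p (bracket D.nvec (e.vec j) p) := fun j => by
      rw [lieCov_apply hs (e.smooth_vec j)]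
      have : dd (fun q => e.coeff i q (e.vec j q)) p (D.nvec p) = 0 := by
        refine (dd_congr (g := fun _ => if i = j then 1 else 0) ?_ _).trans (dd_const _ _)
        filter_upwards [e.coeff_vec] with q hq using hq i j
      rw [this, zero_sub]
    have h3 : lieCov D.nvec (e.coeff i) p (V p)
        = - ∑ j, e.coeff j p (V p) * e.coeff i p (bracket D.nvec (e.vec j) p) := by
      conv_lhs => rw [← hp (V p)]
      simp [h']
    linear_combination h3 - h
  have hbr : ∀ i, bracket D.nvec (fun q => D.P q (T q (e.vec i q))) p
      = D.P p (lieTensor D.nvec T p (e.vec i p)) + A (bracket D.nvec (e.vec i) p)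
        - (2 : ℝ) • D.P p (D.U p (A (e.vec i p))) - (2 * D.s p (A (e.vec i p))) • D.nvec p := by
    intro i
    rw [D.bracket_P ((hT p).apply (e.smooth_vec i)) fun q => hr q _]
    have h : lieCov D.nvec (fun q => T q (e.vec i q)) p
        = lieTensor D.nvec T p (e.vec i p) + T p (bracket D.nvec (e.vec i) p) := by
      refine cov_ext fun Z hZ => ?_
      rw [lieCov_apply ((hT p).apply (e.smooth_vec i)) hZ, LinearMap.add_apply,
        lieTensor_apply (hT p) (e.smooth_vec i) hZ]
      ring
    rw [h]
    simp only [map_sub, map_add, map_smul, A, LinearMap.comp_apply]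
  have hU : D.P p ∘ₗ contractP (D.P p) (LinearMap.flip (T p)) (D.U p)
      = D.P p ∘ₗ D.U p ∘ₗ A := by
    refine LinearMap.ext fun v => congrArg (D.P p) (LinearMap.ext fun w => ?_)
    simp [A, hsym p _ v, D.U_symm _ w, (D.isNullFrame p).P_symm (T p v)]
  have hsA : ∑ i, e.coeff i p (D.nvec p) * D.s p (A (e.vec i p)) = 0 := by
    have : ∑ i, e.coeff i p (D.nvec p) * D.s p (A (e.vec i p))
        = D.s p (A (∑ i, e.coeff i p (D.nvec p) • e.vec i p)) := by simp
    rw [this, hp]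
    simp [A, hn]
  -- The terms with brackets of the frame form the trace of a commutator.
  have hcomm : ∑ i, e.coeff i p (A (bracket D.nvec (e.vec i) p))
      = ∑ i, ∑ j, e.coeff j p (A (e.vec i p)) * e.coeff i p (bracket D.nvec (e.vec j) p) := by
    rw [Finset.sum_comm]
    refine Finset.sum_congr rfl fun j _ => ?_
    conv_lhs => rw [← hp (bracket D.nvec (e.vec j) p)]
    simp [mul_comm]
  rw [traceP, traceP, hU, htr, trace_eq_sum hp, trace_eq_sum hp]
  simp only [hcoeff _ _ (hP _), hbr]
  simp only [map_sub, map_add, map_smul, smul_eq_mul, Finset.sum_sub_distrib,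
    Finset.sum_add_distrib, LinearMap.comp_apply, ← Finset.mul_sum]
  have e1 : ∑ i, 2 * D.s p (A (e.vec i p)) * e.coeff i p (D.nvec p) = 0 := by
    rw [← mul_zero (2 : ℝ), ← hsA, Finset.mul_sum]
    exact Finset.sum_congr rfl fun i _ => by ring
  rw [hcomm, e1]
  simp only [A, LinearMap.comp_apply]
  ring

end NullMetricHypersurfaceData

lemma tensorProd_self {V : Type*} [AddCommGroup V] [Module ℝ V] (α : Dual ℝ V) :
    tensorProd α α = symProd α α := by
  ext u v
  simp only [tensorProd_apply, symProd_apply]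
  ring

namespace NullMetricHypersurfaceData

variable {n : ℕ} {N : Type*} [TopologicalSpace N] [ChartedSpace (EuclideanSpace ℝ (Fin n)) N]
  [IsManifold (𝓡 n) ∞ N] (D : NullMetricHypersurfaceData n N) {p : N}
  {θ : CovField n N} {S T : Tensor02Field n N}

/-! ### The kernel of the energy-momentum map -/

/-- A symmetric tensor which is annihilated by `n` and trace-free with respect to `P` lies in the
kernel of the energy-momentum map. -/
lemma mem_kernelTau {B : LinearMap.BilinForm ℝ (TangentSpace (𝓡 n) p)}
    (hsym : ∀ u v, B u v = B v u) (hn : B (D.nvec p) = 0) (htr : traceP (D.P p) B = 0) :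
    B ∈ D.kernelTau p :=
  ⟨hsym, fun α β => by simp [tau, hn, htr]⟩

/-- `γ(T̄,·) = ι_n T - 𝒬_T ℓ`: the trace part of `T̄` is along `n` and does not contribute. -/
lemma barCov_eq (T : Tensor02Field n N) (p : N) :
    D.barCov T p = T p (D.nvec p) - D.Q T p • D.ℓ p := by
  simp [barCov, barVec, iotaN, Q, (D.isNullFrame p).g_P, γ_nvec]

lemma barCov_nvec (T : Tensor02Field n N) (p : N) : D.barCov T p (D.nvec p) = 0 := by
  simp [barCov_eq, Q, ℓ_nvec]

lemma barCov_eq_zero (hT : T p (D.nvec p) = 0) : D.barCov T p = 0 := by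
  simp [barCov_eq, Q, hT]

lemma partH_nvec (T : Tensor02Field n N) (p : N) : D.partH T p (D.nvec p) = 0 := by
  ext v
  simp [partH, proj, C, ℓ_nvec, γ_nvec, barCov_nvec]
  simp [barCov_eq]

lemma partH_symm (hsym : ∀ u v, T p u v = T p v u) (u v : TangentSpace (𝓡 n) p) :
    D.partH T p u v = D.partH T p v u := by
  simp only [partH, proj, C, LinearMap.sub_apply, LinearMap.add_apply, LinearMap.smul_apply,
    symProd_apply, tensorProd_apply, smul_eq_mul, hsym u v, D.γ_symm u v]
  ring

lemma traceP_γ (p : N) : traceP (D.P p) (D.γ p) = (n : ℝ) - 1 := by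
  have := finiteDimensional_tangentSpace (n := n) p
  rw [(D.isNullFrame p).traceP_g, finrank_tangentSpace]

lemma traceP_symProd_ℓ {η : Dual ℝ (TangentSpace (𝓡 n) p)} (h0 : η (D.nvec p) = 0) :
    traceP (D.P p) (symProd (D.ℓ p) η) = 0 := by
  have := finiteDimensional_tangentSpace (n := n) p
  rw [(D.isNullFrame p).traceP_symProd, (D.isNullFrame p).l_P, h0, mul_zero]

lemma traceP_C (hn : (n : ℝ) - 1 ≠ 0) (p : N) : traceP (D.P p) (D.C p) = 0 := by
  have := finiteDimensional_tangentSpace (n := n) p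
  rw [C, traceP_add, traceP_tensorProd, traceP_smul, traceP_γ, (D.isNullFrame p).l_P, ℓ_nvec,
    div_mul_cancel₀ _ hn]
  ring

lemma traceP_partH (hn : (n : ℝ) - 1 ≠ 0) (T : Tensor02Field n N) (p : N) :
    traceP (D.P p) (D.partH T p) = 0 := by
  simp only [partH, proj, traceP_sub, traceP_add, traceP_smul, traceP_C D hn,
    D.traceP_symProd_ℓ (D.barCov_nvec T p), traceP_γ, div_mul_cancel₀ _ hn, trP]
  ring

lemma partH_mem_kernelTau (hn : (n : ℝ) - 1 ≠ 0) (hsym : ∀ u v, T p u v = T p v u) :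
    D.partH T p ∈ D.kernelTau p :=
  D.mem_kernelTau (D.partH_symm hsym) (D.partH_nvec T p) (D.traceP_partH hn T p)

lemma partH_of_nvec (hT : T p (D.nvec p) = 0) :
    D.partH T p = T p - (D.trP T p / ((n : ℝ) - 1)) • D.γ p := by
  ext u v
  simp [partH, proj, D.barCov_eq_zero hT, Q, hT]

lemma Bmap_of_nvec (hT : T p (D.nvec p) = 0) :
    D.Bmap T p
      = (-2 : ℝ) • symPart (contractP (D.P p) (LinearMap.flip (T p)) (D.U p)) := by
  ext u v
  simp [Bmap, D.barCov_eq_zero hT, Q, hT]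

/-- `£̄_n` preserves the kernel: the correction term of `£̄_n` cancels the contribution of `£_n P` to
the derivative of the trace. -/
lemma lieBar_mem_kernelTau (hT : ∀ q, SmoothTen T q) (hsym : ∀ q u v, T q u v = T q v u)
    (hn : ∀ q, T q (D.nvec q) = 0) (htr : ∀ q, D.trP T q = 0) :
    D.lieBar T p ∈ D.kernelTau p := by
  have hfin := finiteDimensional_tangentSpace (n := n) p
  have h := D.isNullFrame p
  refine D.mem_kernelTau (fun u v => ?_) ?_ ?_
  · rw [lieBar, D.Bmap_of_nvec (hn p)]
    simp only [LinearMap.add_apply, LinearMap.smul_apply, symPart_apply,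
      lieTensor_symm (hT p) hsym u v]
    ring
  · rw [lieBar, D.Bmap_of_nvec (hn p), LinearMap.add_apply, D.lieTensor_nvec (hT p) hn]
    ext v
    simp [D.nvec_eq_zero_right (hsym p) (hn p), U_nvec]
  · have h0 : dd (D.trP T) p (D.nvec p) = 0 :=
      (dd_congr (g := fun _ => 0) (.of_forall htr) _).trans (dd_const _ _)
    rw [lieBar, D.Bmap_of_nvec (hn p), traceP_add, traceP_smul, h.traceP_symPart,
      D.trP_lieTensor hT hsym hn, h0]
    ring

/-- `𝒪(θ)` lies in the kernel: contraction with `n` is governed by the formula for `∇̊n`, and the last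
term of `𝒪` removes the trace since `tr_P γ = n - 1`. -/
lemma Oop_mem_kernelTau (hn : (n : ℝ) - 1 ≠ 0) (hθ : SmoothCov θ p)
    (h0 : ∀ q, θ q (D.nvec q) = 0) : D.Oop θ p ∈ D.kernelTau p := by
  have hfin := finiteDimensional_tangentSpace (n := n) p
  obtain ⟨cov, hc, hconn⟩ := D.exists_conn_eq
  have h := D.isNullFrame p
  have hL := lieCov_self_of_annihilates (D.smooth_nvec p) hθ h0
  refine D.mem_kernelTau (fun u v => ?_) ?_ ?_
  · simp only [Oop, LinearMap.add_apply, LinearMap.sub_apply, LinearMap.smul_apply,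
      LinearMap.flip_apply, symProd_apply, D.γ_symm u v, smul_eq_mul]
    ring
  · ext v
    simp only [Oop, hconn, LinearMap.add_apply, LinearMap.sub_apply, LinearMap.smul_apply,
      LinearMap.flip_apply, symProd_apply, γ_nvec, ℓ_nvec, hL, U_nvec, smul_eq_mul,
      LinearMap.zero_apply, D.nablaCov_nvec_left hc hθ h0, D.nablaCov_nvec_right hc hθ h0]
    ring
  · have hη : (lieCov D.nvec θ p - (2 : ℝ) • LinearMap.flip (D.U p) (D.P p (θ p)))
        (D.nvec p) = 0 := by
      simp [hL, U_nvec]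
    rw [Oop, traceP_sub, traceP_sub, traceP_add, h.traceP_flip, traceP_smul,
      D.traceP_symProd_ℓ hη, traceP_smul, traceP_γ, trP]
    field_simp
    ring

/-! ### The Lie derivative of the kernel component -/

lemma smooth_iotaN (hT : SmoothTen T p) : SmoothCov (D.iotaN T) p :=
  hT.apply (D.smooth_nvec p)

lemma smooth_Q (hT : SmoothTen T p) : SmoothFn (n := n) (D.Q T) p :=
  hT _ _ (D.smooth_nvec p) (D.smooth_nvec p)

lemma smooth_barCov (hT : SmoothTen T p) : SmoothCov (D.barCov T) p :=
  (D.smooth_γ p).apply (.sub (D.smooth_P (D.smooth_iotaN hT))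
    (.smul (.mul (.const _) (D.smooth_trP hT)) (D.smooth_nvec p)))

lemma smooth_partH (hT : SmoothTen T p) : SmoothTen (D.partH T) p :=
  hT.sub (.add (.add (.smul (.const _) ((D.smooth_ℓ p).symProd (D.smooth_barCov hT)))
    (.smul (D.smooth_Q hT) (D.smooth_C p)))
    (.smul ((D.smooth_trP hT).div_const _) (D.smooth_γ p)))

lemma lieTensor_C : lieTensor D.nvec D.C p = (4 : ℝ) • symProd (D.ℓ p) (D.s p)
    + (dd D.ell2 p (D.nvec p) / ((n : ℝ) - 1)) • D.γ p
    + (2 * D.ell2 p / ((n : ℝ) - 1)) • D.U p := by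
  have hℓ := D.smooth_ℓ p
  have e : D.C = fun q => symProd (D.ℓ q) (D.ℓ q) + (D.ell2 q / ((n : ℝ) - 1)) • D.γ q := by
    ext q : 1
    rw [C, tensorProd_self]
  have h2 := (D.smooth_ell2 p).div_const ((n : ℝ) - 1)
  rw [e, lieTensor_add (hℓ.symProd hℓ) (.smul h2 (D.smooth_γ p)), lieTensor_symProd hℓ hℓ,
    lieTensor_smul h2 (D.smooth_γ p), lieCov_ℓ, lieTensor_γ, dd_div_const (D.smooth_ell2 p)]
  ext u v
  simp only [LinearMap.add_apply, LinearMap.smul_apply, smul_eq_mul, symProd_apply]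
  ring

lemma lieTensor_partH (hT : SmoothTen T p) :
    lieTensor D.nvec (D.partH T) p = lieTensor D.nvec T p
      - ((4 : ℝ) • symProd (D.s p) (D.barCov T p)
        + (2 : ℝ) • symProd (D.ℓ p) (lieCov D.nvec (D.barCov T) p)
        + dd (D.Q T) p (D.nvec p) • D.C p + D.Q T p • lieTensor D.nvec D.C p
        + (dd (D.trP T) p (D.nvec p) / ((n : ℝ) - 1)) • D.γ p
        + (2 * D.trP T p / ((n : ℝ) - 1)) • D.U p) := by
  have hℓ := D.smooth_ℓ p
  have hb := D.smooth_barCov hT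
  have hQ := D.smooth_Q hT
  have ht := (D.smooth_trP hT).div_const ((n : ℝ) - 1)
  have h1 : SmoothTen (fun q => (2 : ℝ) • symProd (D.ℓ q) (D.barCov T q)) p :=
    .smul (.const _) (hℓ.symProd hb)
  have h2 : SmoothTen (fun q => D.Q T q • D.C q) p := .smul hQ (D.smooth_C p)
  have h3 : SmoothTen (fun q => (D.trP T q / ((n : ℝ) - 1)) • D.γ q) p :=
    .smul ht (D.smooth_γ p)
  have e : D.partH T = fun q => T q - ((2 : ℝ) • symProd (D.ℓ q) (D.barCov T q)
    + D.Q T q • D.C q + (D.trP T q / ((n : ℝ) - 1)) • D.γ q) := rfl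
  rw [e, lieTensor_sub hT ((h1.add h2).add h3), lieTensor_add (h1.add h2) h3,
    lieTensor_add h1 h2, lieTensor_const_smul _ (hℓ.symProd hb), lieTensor_symProd hℓ hb,
    lieTensor_smul hQ (D.smooth_C p), lieTensor_smul ht (D.smooth_γ p), lieCov_ℓ, lieTensor_γ,
    dd_div_const (D.smooth_trP hT)]
  ext u v
  simp only [LinearMap.add_apply, LinearMap.sub_apply, LinearMap.smul_apply, smul_eq_mul,
    symProd_apply]
  ring

end NullMetricHypersurfaceData

namespace NullHypersurfaceData

variable {n : ℕ} {N : Type*} [TopologicalSpace N] [ChartedSpace (EuclideanSpace ℝ (Fin n)) N]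
  [IsManifold (𝓡 n) ∞ N] (D : NullHypersurfaceData n N) (p : N)

/-! ### The constraint tensor -/

lemma smooth_Y : SmoothTen D.Y p :=
  NullMetricHypersurfaceData.smoothTen_of_contMDiff D.ytensor_smooth p

lemma smooth_w : SmoothCov D.w p := D.smooth_barCov (D.smooth_Y p)

lemma Y_symm (u v : TangentSpace (𝓡 n) p) : D.Y p u v = D.Y p v u := D.ytensor_symm p u v

lemma Q_Y : D.Q D.Y p = - D.κ p := (neg_neg _).symm

lemma smooth_κ : SmoothFn (n := n) D.κ p :=
  ((SmoothFn.const (-1)).mul (D.smooth_Q (D.smooth_Y p))).congr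
    (.of_forall fun q => by rw [Q_Y]; ring)

lemma dd_Q_Y (v : TangentSpace (𝓡 n) p) : dd (D.Q D.Y) p v = - dd D.κ p v := by
  have h : D.Q D.Y = fun q => 0 - D.κ q := by
    ext q
    rw [Q_Y, zero_sub]
  rw [h, dd_sub (SmoothFn.const 0).diff (D.smooth_κ p).diff, dd_const, zero_sub]

/-- `r = w - κ_n ℓ`. -/
lemma r_eq : D.r p = D.w p - D.κ p • D.ℓ p := by
  have h := D.barCov_eq D.Y p
  rw [Q_Y] at h
  rw [w, h]
  change D.Y p (D.nvec p) = _
  module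

lemma w_nvec : D.w p (D.nvec p) = 0 := D.barCov_nvec D.Y p

lemma ws_nvec : D.wsSq p (D.nvec p) = 0 := by
  ext v
  simp [wsSq, w_nvec, D.s_nvec]

lemma ellCoeff_nvec : D.ellCoeff p (D.nvec p) = 0 := by
  simp [ellCoeff, lieCov_self_of_annihilates (D.smooth_nvec p) (D.smooth_w p) D.w_nvec,
    NullMetricHypersurfaceData.Dop, D.ℓ_nvec, D.s_nvec, w_nvec]

lemma symPart_nabla_s_add_r :
    symPart (nablaCov D.conn (fun q => D.s q + (2 : ℝ) • D.r q) p)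
      = symPart (nablaCov D.conn D.s p) + (2 : ℝ) • symPart (nablaCov D.conn D.w p)
        - (2 : ℝ) • symProd (D.ℓ p) (dd D.κ p) + (2 * D.κ p * D.ell2 p) • D.U p := by
  obtain ⟨cov, hc, hconn⟩ := D.exists_conn_eq
  have hw := D.smooth_w p
  have hℓ := D.smooth_ℓ p
  have hκ := D.smooth_κ p
  have e : (fun q => D.s q + (2 : ℝ) • D.r q)
      = fun q => D.s q + (2 : ℝ) • (D.w q - D.κ q • D.ℓ q) := by
    ext q : 1
    rw [r_eq]
  have h1 : SmoothCov (fun q => D.w q - D.κ q • D.ℓ q) p := hw.sub (.smul hκ hℓ)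
  rw [hconn, e, nablaCov_add cov (D.smooth_s p) (.smul (.const _) h1),
    nablaCov_smul cov (.const _) h1, nablaCov_sub cov hw (.smul hκ hℓ), nablaCov_smul cov hκ hℓ]
  have h2 := D.symPart_nabla_ℓ hc (p := p)
  ext u v
  have h3 := congrArg (fun B => B u v) h2
  simp only [LinearMap.add_apply, LinearMap.sub_apply, LinearMap.smul_apply, smul_eq_mul,
    symPart_apply, tensorProd_apply, symProd_apply, LinearMap.neg_apply, dd_const] at h3 ⊢
  linear_combination -2 * D.κ p * h3

/-- The decomposition of the constraint tensor: with `Y = Y^H + ℙ(Y)` and `r = w - κ_n ℓ` inserted,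
both sides are polynomials in the same tensor components. -/
lemma constraintTensor_eq :
    D.constraintTensor p =
        (symPart (ricci D.conn p) + symPart (nablaCov D.conn D.s p)
          + tensorProd (D.s p) (D.s p)
          + (2 : ℝ) • symPart (contractP (D.P p) (LinearMap.flip (D.U p)) (D.F p)))
        + (symProd (D.ℓ p) (D.ellCoeff p) + (D.κ p * D.trP D.U p) • D.C p)
        + (2 / ((n : ℝ) - 1) * D.gammaCoeff p) • D.γ p
        + (-(2 : ℝ) • D.lieBar D.YH p + D.Oop D.w p - (2 : ℝ) • D.partH D.wsSq p
          - (2 * D.κ p + D.trP D.U p) • D.YH p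
          + (2 * D.ell2 p * D.κ p - D.trP D.Y p) • D.UH p) := by
  have h := D.isNullFrame p
  have hUsym := fun u v => D.U_symm (p := p) u v
  have hlie : lieTensor D.nvec D.YH p = _ := D.lieTensor_partH (D.smooth_Y p)
  have hYHn : D.YH p (D.nvec p) = 0 := D.partH_nvec D.Y p
  -- Contractions of `U` through `P`: `U(·,n) = 0` makes `P` invert `γ` on `U`.
  have hUP : ∀ v, D.γ p (D.P p (D.U p v)) = D.U p v := fun v => by
    simp [h.g_P, D.U_nvec_right]
  have hℓUP : ∀ v, D.ℓ p (D.P p (D.U p v)) = 0 := fun v => by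
    simp [h.l_P, D.U_nvec_right]
  have hwUP : ∀ v, D.w p (D.P p (D.U p v)) = D.U p v (D.P p (D.w p)) := fun v =>
    h.P_symm _ _
  have hYUP : ∀ u v, D.Y p (D.P p (D.U p v)) u = D.U p v (D.P p (D.Y p u)) := fun u v => by
    rw [D.Y_symm]; exact h.P_symm _ _
  have hγ : dd (fun q => D.κ q * D.ell2 q - D.trP D.Y q) p (D.nvec p)
      = dd D.κ p (D.nvec p) * D.ell2 p + D.κ p * dd D.ell2 p (D.nvec p)
        - dd (D.trP D.Y) p (D.nvec p) := by
    have h1 := (D.smooth_κ p).mul (D.smooth_ell2 p)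
    rw [dd_sub h1.diff (D.smooth_trP (D.smooth_Y p)).diff,
      dd_mul (D.smooth_κ p).diff (D.smooth_ell2 p).diff]
  have htr : D.trP (fun q => nablaCov D.conn D.w q - D.wsSq q) p
      = D.trP (nablaCov D.conn D.w) p - D.trP D.wsSq p := traceP_sub _ _ _
  rw [constraintTensor, symPart_nabla_s_add_r, NullMetricHypersurfaceData.lieBar, hlie,
    D.Bmap_of_nvec hYHn, D.partH_of_nvec (D.ws_nvec p), UH, D.partH_of_nvec (D.U_nvec p),
    D.lieTensor_C, gammaCoeff, hγ, htr]
  ext u v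
  have hYH : ∀ x y, D.YH p x y = D.Y p x y - (D.ℓ p x * D.w p y + D.ℓ p y * D.w p x
      - D.κ p * (D.ℓ p x * D.ℓ p y + D.ell2 p / ((n : ℝ) - 1) * D.γ p x y)
      + D.trP D.Y p / ((n : ℝ) - 1) * D.γ p x y) := by
    intro x y
    simp only [YH, NullMetricHypersurfaceData.partH, NullMetricHypersurfaceData.proj,
      LinearMap.sub_apply, LinearMap.add_apply, LinearMap.smul_apply, smul_eq_mul, symProd_apply,
      NullMetricHypersurfaceData.C, tensorProd_apply, Q_Y, w]
    ring
  simp only [LinearMap.add_apply, LinearMap.sub_apply, LinearMap.smul_apply, smul_eq_mul,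
    symPart_apply, symProd_apply, tensorProd_apply, contractP_apply, LinearMap.flip_apply,
    hYH, map_add, map_smul, r_eq, ellCoeff, NullMetricHypersurfaceData.Dop,
    NullMetricHypersurfaceData.Oop, NullMetricHypersurfaceData.C, wsSq, dd_Q_Y, Q_Y,
    hUP, hℓUP, hwUP, hYUP]
  rw [hUsym (D.P p (D.Y p u)) v, hUsym (D.P p (D.Y p v)) u, hUsym v u]
  simp only [show D.barCov D.Y = D.w from rfl]
  ring

end NullHypersurfaceData

end NullGeometry

end

theorem theorem6p1 {n : ℕ} (hn : 2 ≤ n) {N : Type*} [TopologicalSpace N] [T2Space N]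
    [SecondCountableTopology N] [ChartedSpace (EuclideanSpace ℝ (Fin n)) N]
    [IsManifold (𝓡 n) ∞ N] (D : NullGeometry.NullHypersurfaceData n N) (p : N) :
    D.constraintTensor p =
        (NullGeometry.symPart (NullGeometry.ricci D.conn p)
          + NullGeometry.symPart (NullGeometry.nablaCov D.conn D.s p)
          + NullGeometry.tensorProd (D.s p) (D.s p)
          + (2 : ℝ) • NullGeometry.symPart
              (NullGeometry.contractP (D.P p) (LinearMap.flip (D.U p)) (D.F p)))
        + (NullGeometry.symProd (D.ℓ p) (D.ellCoeff p) + (D.κ p * D.trP D.U p) • D.C p)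
        + (2 / ((n : ℝ) - 1) * D.gammaCoeff p) • D.γ p
        + (-(2 : ℝ) • D.lieBar D.YH p + D.Oop D.w p - (2 : ℝ) • D.partH D.wsSq p
          - (2 * D.κ p + D.trP D.U p) • D.YH p
          + (2 * D.ell2 p * D.κ p - D.trP D.Y p) • D.UH p) ∧
      D.ellCoeff p (D.nvec p) = 0 ∧
      D.lieBar D.YH p ∈ D.kernelTau p ∧ D.Oop D.w p ∈ D.kernelTau p ∧
      D.partH D.wsSq p ∈ D.kernelTau p ∧ D.YH p ∈ D.kernelTau p ∧ D.UH p ∈ D.kernelTau p := by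
  have hn' : (n : ℝ) - 1 ≠ 0 := by
    have : (2 : ℝ) ≤ n := by exact_mod_cast hn
    linarith
  refine ⟨D.constraintTensor_eq p, D.ellCoeff_nvec p, ?_, ?_, ?_, ?_, ?_⟩
  · exact D.lieBar_mem_kernelTau (fun q => D.smooth_partH (D.smooth_Y q))
      (fun q => D.partH_symm (D.Y_symm q)) (D.partH_nvec D.Y) (D.traceP_partH hn' D.Y)
  · exact D.Oop_mem_kernelTau hn' (D.smooth_w p) D.w_nvec
  · exact D.partH_mem_kernelTau hn' fun u v => mul_comm _ _
  · exact D.partH_mem_kernelTau hn' (D.Y_symm p)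
  · exact D.partH_mem_kernelTau hn' D.U_symm
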